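/- Let $d\ge 1$. For $f\in L^2(\mathbb R^d)$ let $\hat f$ denote the Fourier transform, normalized as $\hat f(\xi)=(2\pi)^{-d/2}\int_{\mathbb R^d}e^{-ix\cdot\xi}f(x)\,dx$, and for $t\in\mathbb R$ let $e^{\pm it|\nabla|}f\in L^2(\mathbb R^d)$ be the function with Fourier transform $e^{\pm it|\xi|}\hat f(\xi)$. Let $\alpha\in\mathbb R$ and $q,p\in[2,\infty]$ satisfy one of the following four conditions: 1. $2\le q<\infty$, $2\le p<\infty$ and $-\frac dp<\alpha<(d-1)\left(\frac12-\frac1p\right)-\frac1q$; 2. $q=\infty$, $2\le p<\infty$ and $-\frac dp<\alpha\le(d-1)\left(\frac12-\frac1p\right)$; 3. $2\le q<\infty$, $p=\infty$ and $0\le\alpha<\frac{d-1}2-\frac1q$; 4. $q=p=\infty$ and $0\le\alpha\le\frac{d-1}2$. Then there is a constant $C>0$, depending only on $d,\alpha,q,p$, such that the following holds. Let $f\in L^2(\mathbb R^d)$ be radial, let $0<\delta\le1$, and let $I\subseteq[\frac12,2]$ be an interval of length $|I|\le\delta$ such that $\hat f(\xi)=0$ for almost every $\xi$ with $|\xi|\notin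 I$. Then, for both choices of the sign, $$\left\|\,|x|^\alpha e^{\pm it|\nabla|}f\,\right\|_{L^q_tL^p_x(\mathbb R\times\mathbb R^d)}\le C\,\delta^{\frac12-\frac1{\min(p,q)}}\,\|f\|_{L^2(\mathbb R^d)},$$ where $\|F\|_{L^q_tL^p_x}=\big\|\,t\mapsto\|F(t,\cdot)\|_{L^p(\mathbb R^d)}\big\|_{L^q(\mathbb R)}$ and $\frac1\infty=0$. -/

import Mathlib

open MeasureTheory
open scoped ENNReal FourierTransform

namespace RadialStrichartz

/-- The space `L²(ℝᵈ; ℂ)`. -/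
abbrev L2 (d : ℕ) : Type :=
  Lp (α := EuclideanSpace ℝ (Fin d)) ℂ 2 volume

/-- `f ∈ L²_rad(ℝᵈ)`: almost everywhere, `f x` is a measurable function of `|x|`. -/
def IsRadial {d : ℕ} (f : L2 d) : Prop :=
  ∃ g : ℝ → ℂ, Measurable g ∧ ∀ᵐ x : EuclideanSpace ℝ (Fin d), f x = g ‖x‖

/-- The (Plancherel) Fourier transform in the normalization
`f̂(ξ) = (2π)^(-d/2) ∫ exp(-i x·ξ) f(x) dx`. Mathlib's `𝓕` uses `∫ exp(-2πi x·ξ) f(x) dx`, so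
`f̂(ξ) = (2π)^(-d/2) (𝓕 f)(ξ / 2π)`. It is defined up to null sets. -/
noncomputable def hat {d : ℕ} (f : L2 d) (ξ : EuclideanSpace ℝ (Fin d)) : ℂ :=
  (((2 * Real.pi) ^ (-(d : ℝ) / 2) : ℝ) : ℂ) * (𝓕 f : L2 d) ((2 * Real.pi)⁻¹ • ξ)

theorem memLp_phase {d : ℕ} (t : ℝ) (g : L2 d) :
    MemLp (fun η : EuclideanSpace ℝ (Fin d) =>
      Complex.exp (((t * (2 * Real.pi * ‖η‖) : ℝ) : ℂ) * Complex.I) * g η) 2 volume := by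
  have hc : Continuous fun η : EuclideanSpace ℝ (Fin d) =>
      Complex.exp (((t * (2 * Real.pi * ‖η‖) : ℝ) : ℂ) * Complex.I) := by fun_prop
  refine (Lp.memLp g).of_le (hc.aestronglyMeasurable.mul (Lp.aestronglyMeasurable g)) ?_
  filter_upwards with η
  rw [norm_mul, Complex.norm_exp_ofReal_mul_I, one_mul]

/-- The half-wave evolution `e^{it|∇|} f` on `L²`, the Fourier multiplier with symbol `e^{it|ξ|}`.
In the frequency variable `η = ξ / 2π` of Mathlib's `𝓕` the symbol is `e^{it 2π|η|}`. -/
noncomputable def halfWave {d : ℕ} (t : ℝ) (f : L2 d) : L2 d :=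
  𝓕⁻ (MemLp.toLp _ (memLp_phase t (𝓕 f : L2 d)) : L2 d)

/-- The mixed norm `‖ |x|^α u ‖_{L^q_t L^p_x(ℝ × ℝᵈ)}`, with values in `[0, ∞]`, of a curve
`t ↦ u t` in `L²(ℝᵈ)`. -/
noncomputable def weightedMixedNorm {d : ℕ} (α : ℝ) (q p : ℝ≥0∞) (u : ℝ → L2 d) : ℝ≥0∞ :=
  eLpNorm (fun t : ℝ =>
    eLpNorm (fun x : EuclideanSpace ℝ (Fin d) => ((‖x‖ ^ α : ℝ) : ℂ) * u t x) p volume) q volume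

/-- `1/p` as a real number, with `1/∞ = 0`. -/
noncomputable def recip (p : ℝ≥0∞) : ℝ := (p⁻¹).toReal

/-- The admissible range of weights and exponents `(α, q, p)` in dimension `d`. -/
def Admissible (d : ℕ) (α : ℝ) (q p : ℝ≥0∞) : Prop :=
  ((2 ≤ q ∧ q < ∞) ∧ (2 ≤ p ∧ p < ∞) ∧
    -(d : ℝ) * recip p < α ∧ α < ((d : ℝ) - 1) * (1 / 2 - recip p) - recip q) ∨
  (q = ∞ ∧ (2 ≤ p ∧ p < ∞) ∧
    -(d : ℝ) * recip p < α ∧ α ≤ ((d : ℝ) - 1) * (1 / 2 - recip p)) ∨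
  ((2 ≤ q ∧ q < ∞) ∧ p = ∞ ∧ 0 ≤ α ∧ α < ((d : ℝ) - 1) / 2 - recip q) ∨
  (q = ∞ ∧ p = ∞ ∧ 0 ≤ α ∧ α ≤ ((d : ℝ) - 1) / 2)

end RadialStrichartz

/-!
# Weighted Strichartz estimates for radial, frequency-localized half-waves

Write `d = n + 1`. The Fourier transform of a radial `f` is radial (`IsRadial.fourier`), so in polar
coordinates the half-wave with data `f` of frequencies `|ξ| ∈ I` becomes a one-dimensional oscillatory integral
`U(t, r) = ∫ m(ρ) exp(2πitρ) k(2πρr) dρ` (`exists_profile`), where `k = sphK n` is the Fourier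
transform of the surface measure of the sphere and `m` is square integrable and supported on a set of
measure at most `δ`.

The only information needed on `k` is that `k` and `k'` decay like `(1 + s)^(-n/2)`
(`exists_sphK_decay`). This is proved without stationary phase: rotation invariance of the sphere gives
the equation `s (k'' + k) = -n k'` (`sphK_ode`), and `s^n (k² + k'²)` is conserved up to an integrable
error (`ode_energy_bound`).

For fixed `r` both `U(·, r)` and `∂ᵣU(·, r)` are Fourier transforms of functions supported in a set of
measure at most `δ`, so Cauchy-Schwarz and Plancherel bound them by `(1 + r)^(-n/2) ‖f‖` times `√δ` in
`L^∞` in time and times `1` in `L²` in time. Averaging over a unit interval of radii produces a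
majorant `S k t` of `|U(t, r)|` on the shell `k ≤ r < k + 1` with the same bounds
(`exists_shell_majorant`); interpolating, `‖S k‖_{L^q} ≲ (1 + k)^(-n/2) δ^(1/2 - 1/q) ‖f‖`.

The mixed norm estimate follows from these bounds and conservation of the `L²` norm, collected in
`ShellBound`.
* If `q ≤ p`, the sum over the shells is taken in `ℓ^q ⊆ ℓ^p`, and it converges precisely because
  `α < n (1/2 - 1/p) - 1/q` (`exists_mixed_le_of_le`, `exists_mixed_le_top`).
* If `q = ∞`, the `L^p` norm at a fixed time outside the unit ball interpolates between the decay
  estimate and the `L²` norm; this includes the endpoint weight (`exists_mixed_top_le`).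
* If `p < q < ∞`, Hölder's inequality in `x` reduces the outer region to the cases `q = p` and `q = ∞`
  (`exists_mixed_le_of_lt`).

The unit ball is a single shell, on which the weight is integrable since `α > -d/p`.
-/

open Filter

namespace RadialStrichartz

/-! ### The Fourier transform on `L¹ ∩ L²` -/

section Fourier

variable {V : Type*} [NormedAddCommGroup V] [InnerProductSpace ℝ V] [FiniteDimensional ℝ V]
  [MeasurableSpace V] [BorelSpace V]

theorem continuous_fourier {g : V → ℂ} (hg : Integrable g) : Continuous (𝓕 g) :=
  VectorFourier.fourierIntegral_continuous Real.continuous_fourierChar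
    (innerSL ℝ).continuous₂ hg

theorem continuous_fourierInv {g : V → ℂ} (hg : Integrable g) : Continuous (𝓕⁻ g) := by
  have : (𝓕⁻ g) = fun x => 𝓕 g (-x) := funext fun x => Real.fourierInv_eq_fourier_neg g x
  rw [this]
  exact (continuous_fourier hg).comp continuous_neg

/-- On `L¹ ∩ L²` the Plancherel transform is given by the Fourier integral: both represent the same
tempered distribution. -/
theorem fourier_toLp_ae_eq {g : V → ℂ} (hg : MemLp g 2) (hg1 : Integrable g) :
    (𝓕 (hg.toLp g) : Lp (α := V) ℂ 2 volume) =ᵐ[volume] 𝓕 g := by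
  refine ae_eq_of_integral_contDiff_smul_eq
    ((Lp.memLp _).locallyIntegrable (by norm_num))
    (continuous_fourier hg1).locallyIntegrable fun φ hφ hc => ?_
  have hc' : HasCompactSupport (Complex.ofRealCLM ∘ φ) := hc.comp_left rfl
  have hφ' : ContDiff ℝ (⊤ : ℕ∞) (Complex.ofRealCLM ∘ φ) := by fun_prop
  set ψ : SchwartzMap V ℂ := hc'.toSchwartzMap hφ'
  have h := congrArg (fun T => T ψ) (Lp.fourier_toTemperedDistribution_eq (hg.toLp g))
  simp only [TemperedDistribution.fourier_apply, Lp.toTemperedDistribution_apply] at h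
  have h2 : ∫ x, (𝓕 ψ) x • (hg.toLp g : V → ℂ) x = ∫ x, (𝓕 (ψ : V → ℂ)) x • g x := by
    refine integral_congr_ae ?_
    filter_upwards [hg.coeFn_toLp] with x hx
    rw [hx, SchwartzMap.fourier_coe]
  have h3 : ∫ x, (𝓕 (ψ : V → ℂ)) x • g x = ∫ x, ψ x • 𝓕 g x := by
    have := VectorFourier.integral_fourierIntegral_smul_eq_flip (μ := (volume : Measure V))
      (ν := (volume : Measure V)) (L := innerₗ V)
      Real.continuous_fourierChar (innerSL ℝ).continuous₂ (ψ.integrable (μ := volume)) hg1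
    rwa [flip_innerₗ] at this
  calc _ = ∫ x, ψ x • (𝓕 (hg.toLp g) : Lp (α := V) ℂ 2 volume) x := by
        refine integral_congr_ae (.of_forall fun x => ?_); simp [ψ]
    _ = ∫ x, ψ x • 𝓕 g x := by rw [← h, h2, h3]
    _ = _ := by refine integral_congr_ae (.of_forall fun x => ?_); simp [ψ]

theorem fourierInv_toLp_ae_eq {g : V → ℂ} (hg : MemLp g 2) (hg1 : Integrable g) :
    (𝓕⁻ (hg.toLp g) : Lp (α := V) ℂ 2 volume) =ᵐ[volume] 𝓕⁻ g := by
  refine ae_eq_of_integral_contDiff_smul_eq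
    ((Lp.memLp _).locallyIntegrable (by norm_num))
    (continuous_fourierInv hg1).locallyIntegrable fun φ hφ hc => ?_
  have hc' : HasCompactSupport (Complex.ofRealCLM ∘ φ) := hc.comp_left rfl
  have hφ' : ContDiff ℝ (⊤ : ℕ∞) (Complex.ofRealCLM ∘ φ) := by fun_prop
  set ψ : SchwartzMap V ℂ := hc'.toSchwartzMap hφ'
  have h := congrArg (fun T => T ψ) (Lp.fourierInv_toTemperedDistribution_eq (hg.toLp g))
  simp only [TemperedDistribution.fourierInv_apply, Lp.toTemperedDistribution_apply] at h
  have h2 : ∫ x, (𝓕⁻ ψ) x • (hg.toLp g : V → ℂ) x = ∫ x, (𝓕⁻ (ψ : V → ℂ)) x • g x := by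
    refine integral_congr_ae ?_
    filter_upwards [hg.coeFn_toLp] with x hx
    rw [hx, SchwartzMap.fourierInv_coe]
  have h3 : ∫ x, (𝓕⁻ (ψ : V → ℂ)) x • g x = ∫ x, ψ x • 𝓕⁻ g x := by
    have := VectorFourier.integral_fourierIntegral_smul_eq_flip (μ := (volume : Measure V))
      (ν := (volume : Measure V)) (L := -innerₗ V)
      Real.continuous_fourierChar (innerSL ℝ).continuous₂.neg (ψ.integrable (μ := volume)) hg1
    have hfl : (-innerₗ V).flip = -innerₗ V := by
      ext x y; simp [real_inner_comm]
    rwa [hfl] at this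
  calc _ = ∫ x, ψ x • (𝓕⁻ (hg.toLp g) : Lp (α := V) ℂ 2 volume) x := by
        refine integral_congr_ae (.of_forall fun x => ?_); simp [ψ]
    _ = ∫ x, ψ x • 𝓕⁻ g x := by rw [← h, h2, h3]
    _ = _ := by refine integral_congr_ae (.of_forall fun x => ?_); simp [ψ]

theorem norm_fourierInv_L2 (f : Lp (α := V) ℂ 2 volume) : ‖(𝓕⁻ f : Lp (α := V) ℂ 2 volume)‖ = ‖f‖ :=
  (Lp.fourierTransformₗᵢ V ℂ).symm.norm_map f

theorem eLpNorm_fourierInv {g : V → ℂ} (hg : MemLp g 2) (hg1 : Integrable g) :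
    eLpNorm (𝓕⁻ g) 2 volume = eLpNorm g 2 volume := by
  rw [← eLpNorm_congr_ae (fourierInv_toLp_ae_eq hg hg1), ← eLpNorm_congr_ae hg.coeFn_toLp,
    ← Lp.enorm_def, ← Lp.enorm_def, ← ofReal_norm, ← ofReal_norm, norm_fourierInv_L2]

end Fourier

/-! ### The Fourier transform of the surface measure of the sphere -/

/-- The surface measure of the unit sphere of `ℝⁿ⁺¹`. -/
noncomputable abbrev surf (n : ℕ) : Measure (Metric.sphere (0 : EuclideanSpace ℝ (Fin (n + 1))) 1) :=
  (volume : Measure (EuclideanSpace ℝ (Fin (n + 1)))).toSphere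

open scoped Pointwise in
theorem integral_surf_comp_isometry {n : ℕ}
    (L : EuclideanSpace ℝ (Fin (n + 1)) ≃ₗᵢ[ℝ] EuclideanSpace ℝ (Fin (n + 1)))
    (F : EuclideanSpace ℝ (Fin (n + 1)) → ℝ) :
    ∫ ω, F (L ω) ∂(surf n) = ∫ ω, F ω ∂(surf n) := by
  have hT : ∀ ω : Metric.sphere (0 : EuclideanSpace ℝ (Fin (n + 1))) 1,
      L ω ∈ Metric.sphere (0 : EuclideanSpace ℝ (Fin (n + 1))) 1 := fun ω => by simp
  have hT' : ∀ ω : Metric.sphere (0 : EuclideanSpace ℝ (Fin (n + 1))) 1,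
      L.symm ω ∈ Metric.sphere (0 : EuclideanSpace ℝ (Fin (n + 1))) 1 := fun ω => by simp
  let T : Metric.sphere (0 : EuclideanSpace ℝ (Fin (n + 1))) 1 ≃ₜ
      Metric.sphere (0 : EuclideanSpace ℝ (Fin (n + 1))) 1 :=
    { toFun := fun ω => ⟨L ω, hT ω⟩
      invFun := fun ω => ⟨L.symm ω, hT' ω⟩
      left_inv := fun ω => by simp
      right_inv := fun ω => by simp
      continuous_toFun := by fun_prop
      continuous_invFun := by fun_prop }
  have hmp : MeasurePreserving T (surf n) (surf n) := by
    refine ⟨T.measurable, ?_⟩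
    ext s hs
    rw [Measure.map_apply T.measurable hs, Measure.toSphere_apply' _ hs,
      Measure.toSphere_apply' _ (T.measurable hs)]
    congr 1
    have : Set.Ioo (0 : ℝ) 1 • ((↑) '' (T ⁻¹' s) : Set (EuclideanSpace ℝ (Fin (n + 1))))
        = L ⁻¹' (Set.Ioo (0 : ℝ) 1 • ((↑) '' s)) := by
      ext x
      simp only [Set.mem_smul, Set.mem_image, Set.mem_preimage]
      constructor
      · rintro ⟨r, hr, _, ⟨ω, hω, rfl⟩, rfl⟩
        exact ⟨r, hr, _, ⟨T ω, hω, rfl⟩, by simp [T]⟩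
      · rintro ⟨r, hr, _, ⟨ω, hω, rfl⟩, h⟩
        refine ⟨r, hr, _, ⟨T.symm ω, by simpa using hω, rfl⟩, ?_⟩
        apply L.injective
        rw [← h]
        simp [T]
    rw [this]
    exact L.measurePreserving.measure_preimage_emb
      L.toHomeomorph.measurableEmbedding _
  exact hmp.integral_comp T.measurableEmbedding (fun ω => F ω)

/-- The plane waves averaged over the sphere depend only on the length of the frequency. -/
theorem integral_surf_inner_eq_of_norm_eq {n : ℕ} (Φ : ℝ → ℝ)
    {y z : EuclideanSpace ℝ (Fin (n + 1))} (h : ‖y‖ = ‖z‖) :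
    ∫ ω, Φ (inner ℝ y ω.1) ∂(surf n) = ∫ ω, Φ (inner ℝ z ω.1) ∂(surf n) := by
  have hL := Submodule.reflection_sub h
  rw [← hL, ← integral_surf_comp_isometry (Submodule.reflection (ℝ ∙ (y - z))ᗮ)
    (fun ω => Φ (inner ℝ ((Submodule.reflection (ℝ ∙ (y - z))ᗮ) y) ω))]
  simp [LinearIsometryEquiv.inner_map_map]

theorem hasDerivAt_integral_surf {n : ℕ}
    {F F' : ℝ → Metric.sphere (0 : EuclideanSpace ℝ (Fin (n + 1))) 1 → ℝ} {B : ℝ} (s : ℝ)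
    (hF : ∀ t, Continuous (F t)) (hF' : ∀ t, Continuous (F' t))
    (hB : ∀ t ∈ Metric.ball s 1, ∀ ω, |F' t ω| ≤ B)
    (h : ∀ t ω, HasDerivAt (fun t => F t ω) (F' t ω) t) :
    HasDerivAt (fun t => ∫ ω, F t ω ∂(surf n)) (∫ ω, F' s ω ∂(surf n)) s := by
  have hc : CompactSpace (Metric.sphere (0 : EuclideanSpace ℝ (Fin (n + 1))) 1) := inferInstance
  refine (hasDerivAt_integral_of_dominated_loc_of_deriv_le (bound := fun _ => B)
    (Metric.ball_mem_nhds s one_pos) ?_ ?_ ?_ ?_ ?_ ?_).2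
  · exact .of_forall fun t => (hF t).aestronglyMeasurable
  · exact (hF s).integrable_of_hasCompactSupport (HasCompactSupport.of_compactSpace _)
  · exact (hF' s).aestronglyMeasurable
  · exact .of_forall fun ω t ht => hB t ht ω
  · exact integrable_const _
  · exact .of_forall fun ω t _ => h t ω

theorem abs_sphere_coord_le {n : ℕ} (ω : Metric.sphere (0 : EuclideanSpace ℝ (Fin (n + 1))) 1)
    (j : Fin (n + 1)) : |ω.1 j| ≤ 1 := by
  have := PiLp.norm_apply_le ω.1 j
  rwa [Real.norm_eq_abs, norm_eq_of_mem_sphere] at this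

/-- The average of plane waves of frequency `s` over the sphere, i.e. the radial profile of the
Fourier transform of the surface measure. -/
noncomputable def sphK (n : ℕ) (s : ℝ) : ℝ := ∫ ω, Real.cos (s * ω.1 0) ∂(surf n)

/-- The first derivative of `sphK`. -/
noncomputable def sphK' (n : ℕ) (s : ℝ) : ℝ := ∫ ω, -(ω.1 0) * Real.sin (s * ω.1 0) ∂(surf n)

/-- The second derivative of `sphK`. -/
noncomputable def sphK'' (n : ℕ) (s : ℝ) : ℝ := ∫ ω, -(ω.1 0) ^ 2 * Real.cos (s * ω.1 0) ∂(surf n)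

theorem integrable_surf {n : ℕ} {F : Metric.sphere (0 : EuclideanSpace ℝ (Fin (n + 1))) 1 → ℝ}
    (hF : Continuous F) : Integrable F (surf n) :=
  hF.integrable_of_hasCompactSupport (HasCompactSupport.of_compactSpace _)

theorem hasDerivAt_sphK (n : ℕ) (s : ℝ) : HasDerivAt (sphK n) (sphK' n s) s := by
  refine hasDerivAt_integral_surf (B := 1) s (F := fun t ω => Real.cos (t * ω.1 0))
    (F' := fun t ω => -(ω.1 0) * Real.sin (t * ω.1 0)) (fun t => by fun_prop) (fun t => by fun_prop)
    ?_ ?_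
  · intro t _ ω
    rw [abs_mul, abs_neg]
    exact mul_le_one₀ (abs_sphere_coord_le ω 0) (abs_nonneg _) (Real.abs_sin_le_one _)
  · intro t ω
    have := ((hasDerivAt_id t).mul_const (ω.1 0)).cos
    refine this.congr_deriv ?_
    simp; ring

theorem hasDerivAt_sphK' (n : ℕ) (s : ℝ) : HasDerivAt (sphK' n) (sphK'' n s) s := by
  refine hasDerivAt_integral_surf (B := 1) s (F := fun t ω => -(ω.1 0) * Real.sin (t * ω.1 0))
    (F' := fun t ω => -(ω.1 0) ^ 2 * Real.cos (t * ω.1 0)) (fun t => by fun_prop)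
    (fun t => by fun_prop) ?_ ?_
  · intro t _ ω
    rw [abs_mul, abs_neg, abs_pow]
    exact mul_le_one₀ (pow_le_one₀ (abs_nonneg _) (abs_sphere_coord_le ω 0)) (abs_nonneg _)
      (Real.abs_cos_le_one _)
  · intro t ω
    have := (((hasDerivAt_id t).mul_const (ω.1 0)).sin).const_mul (-(ω.1 0))
    refine this.congr_deriv ?_
    simp; ring

theorem abs_sphK_le (n : ℕ) (s : ℝ) : |sphK n s| ≤ (surf n).real Set.univ := by
  have := norm_integral_le_of_norm_le_const (μ := surf n) (C := 1)
    (f := fun ω => Real.cos (s * ω.1 0)) (.of_forall fun ω => Real.abs_cos_le_one _)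
  simpa [sphK] using this

theorem abs_sphK'_le (n : ℕ) (s : ℝ) : |sphK' n s| ≤ (surf n).real Set.univ := by
  have := norm_integral_le_of_norm_le_const (μ := surf n) (C := 1)
    (f := fun ω => -(ω.1 0) * Real.sin (s * ω.1 0)) (.of_forall fun ω => by
      rw [norm_mul, norm_neg]
      exact mul_le_one₀ (abs_sphere_coord_le ω 0) (abs_nonneg _) (Real.abs_sin_le_one _))
  simpa [sphK'] using this

/-- Invariance of the surface measure under rotations in the plane of `e₀` and `eⱼ`, differentiated
twice at the identity. -/
theorem integral_surf_rotation {n : ℕ} (s : ℝ) {j : Fin (n + 1)} (hj : j ≠ 0) :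
    ∫ ω, (s * ω.1 0 * Real.sin (s * ω.1 0) - s ^ 2 * ω.1 j ^ 2 * Real.cos (s * ω.1 0)) ∂(surf n)
      = 0 := by
  -- a circle of radius `s` through `s e₀`, on which the averaged plane wave is constant
  let y : ℝ → EuclideanSpace ℝ (Fin (n + 1)) := fun θ =>
    EuclideanSpace.single 0 (s * Real.cos θ) + EuclideanSpace.single j (s * Real.sin θ)
  have hy : ∀ θ, ‖y θ‖ = ‖y 0‖ := by
    have hsq : ∀ θ, ‖y θ‖ ^ 2 = s ^ 2 := by
      intro θ
      rw [← real_inner_self_eq_norm_sq]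
      simp only [y, inner_add_left, inner_add_right, EuclideanSpace.inner_single_left,
        PiLp.single_apply, hj, hj.symm, if_true, if_false]
      simp
      linear_combination s ^ 2 * Real.sin_sq_add_cos_sq θ
    intro θ
    rw [← abs_of_nonneg (norm_nonneg (y θ)), ← abs_of_nonneg (norm_nonneg (y 0)),
      ← sq_eq_sq_iff_abs_eq_abs, hsq, hsq]
  have hin : ∀ θ (ω : EuclideanSpace ℝ (Fin (n + 1))),
      inner ℝ (y θ) ω = s * (Real.cos θ * ω 0 + Real.sin θ * ω j) := by
    intro θ ω
    simp only [y, inner_add_left, EuclideanSpace.inner_single_left]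
    simp; ring
  have hconst : ∀ θ, ∫ ω, Real.cos (s * (Real.cos θ * ω.1 0 + Real.sin θ * ω.1 j)) ∂(surf n)
      = ∫ ω, Real.cos (inner ℝ (y 0) ω.1) ∂(surf n) := by
    intro θ
    rw [← integral_surf_inner_eq_of_norm_eq Real.cos (hy θ)]
    simp_rw [hin]
  have hA : ∀ (ω : Metric.sphere (0 : EuclideanSpace ℝ (Fin (n + 1))) 1) θ, HasDerivAt
      (fun θ => s * (Real.cos θ * ω.1 0 + Real.sin θ * ω.1 j))
      (s * (-Real.sin θ * ω.1 0 + Real.cos θ * ω.1 j)) θ := fun ω θ =>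
    (((Real.hasDerivAt_cos θ).mul_const _).add ((Real.hasDerivAt_sin θ).mul_const _)).const_mul s
  have hB : ∀ (ω : Metric.sphere (0 : EuclideanSpace ℝ (Fin (n + 1))) 1) θ, HasDerivAt
      (fun θ => s * (-Real.sin θ * ω.1 0 + Real.cos θ * ω.1 j))
      (s * (-Real.cos θ * ω.1 0 + -Real.sin θ * ω.1 j)) θ := fun ω θ =>
    (((Real.hasDerivAt_sin θ).neg.mul_const _).add
      ((Real.hasDerivAt_cos θ).mul_const _)).const_mul s
  have hbd : ∀ (a b : ℝ) (ω : Metric.sphere (0 : EuclideanSpace ℝ (Fin (n + 1))) 1),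
      |a| ≤ 1 → |b| ≤ 1 → |s * (a * ω.1 0 + b * ω.1 j)| ≤ 2 * |s| := by
    intro a b ω ha hb
    have h1 : |a * ω.1 0 + b * ω.1 j| ≤ 2 := by
      refine (abs_add_le _ _).trans ?_
      rw [abs_mul, abs_mul]
      have := mul_le_one₀ ha (abs_nonneg _) (abs_sphere_coord_le ω 0)
      have := mul_le_one₀ hb (abs_nonneg _) (abs_sphere_coord_le ω j)
      linarith
    rw [abs_mul, mul_comm]
    exact mul_le_mul_of_nonneg_right h1 (abs_nonneg s)
  have hd1 : ∀ θ, ∫ ω, -Real.sin (s * (Real.cos θ * ω.1 0 + Real.sin θ * ω.1 j)) *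
      (s * (-Real.sin θ * ω.1 0 + Real.cos θ * ω.1 j)) ∂(surf n) = 0 := by
    intro θ
    have h1 := hasDerivAt_integral_surf (n := n) (B := 2 * |s|) θ
      (F := fun θ ω => Real.cos (s * (Real.cos θ * ω.1 0 + Real.sin θ * ω.1 j)))
      (F' := fun θ ω => -Real.sin (s * (Real.cos θ * ω.1 0 + Real.sin θ * ω.1 j)) *
        (s * (-Real.sin θ * ω.1 0 + Real.cos θ * ω.1 j)))
      (fun t => by fun_prop) (fun t => by fun_prop)
      (fun t _ ω => by
        rw [abs_mul, abs_neg, ← one_mul (2 * |s|)]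
        exact mul_le_mul (Real.abs_sin_le_one _)
          (hbd _ _ ω (by rw [abs_neg]; exact Real.abs_sin_le_one _) (Real.abs_cos_le_one _))
          (abs_nonneg _) zero_le_one)
      (fun t ω => (hA ω t).cos)
    simp_rw [hconst] at h1
    exact h1.unique (hasDerivAt_const _ _)
  have h2 := hasDerivAt_integral_surf (n := n) (B := (2 * |s|) * (2 * |s|) + 2 * |s|) 0
      (F := fun θ ω => -Real.sin (s * (Real.cos θ * ω.1 0 + Real.sin θ * ω.1 j)) *
        (s * (-Real.sin θ * ω.1 0 + Real.cos θ * ω.1 j)))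
      (F' := fun θ ω => -(Real.cos (s * (Real.cos θ * ω.1 0 + Real.sin θ * ω.1 j)) *
        (s * (-Real.sin θ * ω.1 0 + Real.cos θ * ω.1 j))) *
        (s * (-Real.sin θ * ω.1 0 + Real.cos θ * ω.1 j)) +
        -Real.sin (s * (Real.cos θ * ω.1 0 + Real.sin θ * ω.1 j)) *
        (s * (-Real.cos θ * ω.1 0 + -Real.sin θ * ω.1 j)))
      (fun t => by fun_prop) (fun t => by fun_prop)
      (fun t _ ω => by
        have hb := hbd _ _ ω (by rw [abs_neg]; exact Real.abs_sin_le_one t)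
          (Real.abs_cos_le_one t)
        have hc := hbd _ _ ω (by rw [abs_neg]; exact Real.abs_cos_le_one t)
          (by rw [abs_neg]; exact Real.abs_sin_le_one t)
        refine (abs_add_le _ _).trans (add_le_add ?_ ?_)
        · rw [abs_mul, abs_neg, abs_mul]
          refine mul_le_mul ?_ hb (abs_nonneg _) (by positivity)
          refine (mul_le_of_le_one_left (abs_nonneg _) (Real.abs_cos_le_one _)).trans hb
        · rw [abs_mul, abs_neg]
          exact (mul_le_of_le_one_left (abs_nonneg _) (Real.abs_sin_le_one _)).trans hc)
      (fun t ω => ((hA ω t).sin.neg).mul (hB ω t))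
  simp_rw [hd1] at h2
  have h3 := h2.unique (hasDerivAt_const _ _)
  rw [← h3]
  refine integral_congr_ae (.of_forall fun ω => ?_)
  simp
  ring

/-- The Bessel-type equation `s (k'' + k) = - n k'`, the radial form of `ΔK = -K`. -/
theorem sphK_ode (n : ℕ) (s : ℝ) : s * (sphK'' n s + sphK n s) = -(n * sphK' n s) := by
  rcases eq_or_ne s 0 with rfl | hs
  · simp [sphK']
  have hsum : ∀ ω : Metric.sphere (0 : EuclideanSpace ℝ (Fin (n + 1))) 1,
      ω.1 0 ^ 2 + ∑ j : Fin n, ω.1 j.succ ^ 2 = 1 := by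
    intro ω
    have h := EuclideanSpace.real_norm_sq_eq ω.1
    rw [norm_eq_of_mem_sphere, Fin.sum_univ_succ] at h
    linarith
  have h0 : ∑ j : Fin n, ∫ ω, (s * ω.1 0 * Real.sin (s * ω.1 0) -
      s ^ 2 * ω.1 j.succ ^ 2 * Real.cos (s * ω.1 0)) ∂(surf n) = 0 :=
    Finset.sum_eq_zero fun j _ => integral_surf_rotation s (Fin.succ_ne_zero j)
  rw [← integral_finsetSum _ fun j _ => integrable_surf (by fun_prop)] at h0
  have h1 : ∫ ω, (s * ((-s) * (Real.cos (s * ω.1 0)) + (-s) * (-(ω.1 0) ^ 2 * Real.cos (s * ω.1 0)))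
      + (-(n * s)) * (-(ω.1 0) * Real.sin (s * ω.1 0))) ∂(surf n) = 0 := by
    rw [← h0]
    refine integral_congr_ae (.of_forall fun ω => ?_)
    simp only [Finset.sum_sub_distrib, Finset.sum_const, Finset.card_univ, Fintype.card_fin,
      ← Finset.sum_mul, ← Finset.mul_sum, nsmul_eq_mul]
    linear_combination (s ^ 2 * Real.cos (s * ω.1 0)) * hsum ω
  rw [integral_add (integrable_surf (by fun_prop)) (integrable_surf (by fun_prop)),
    integral_const_mul, integral_const_mul, integral_add (integrable_surf (by fun_prop))
      (integrable_surf (by fun_prop)), integral_const_mul, integral_const_mul] at h1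
  change s * (-s * sphK n s + -s * sphK'' n s) + -(n * s) * sphK' n s = 0 at h1
  apply mul_left_cancel₀ hs
  linarith

/-- Decay of solutions of `s (k'' + k) = - n k'`: the energy
`s^n (k² + k'²) + n s^(n-1) k k'` is almost conserved. -/
theorem ode_energy_bound {n : ℕ} {k k' k'' : ℝ → ℝ} (hk : ∀ s, HasDerivAt k (k' s) s)
    (hk' : ∀ s, HasDerivAt k' (k'' s) s) (hode : ∀ s, s * (k'' s + k s) = -(n * k' s)) :
    ∃ C, ∀ s : ℝ, (n : ℝ) + 1 ≤ s → s ^ n * (k s ^ 2 + k' s ^ 2) ≤ C := by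
  set A : ℝ → ℝ := fun s => k s ^ 2 + k' s ^ 2 + n / s * (k s * k' s) with hA
  have hn : (0 : ℝ) ≤ n := n.cast_nonneg
  have hpos : ∀ s : ℝ, (n : ℝ) + 1 ≤ s → 0 < s := fun s hs => by linarith
  -- for `s ≥ n + 1` the correction term is absorbed by half of the energy
  have hcmp : ∀ s : ℝ, (n : ℝ) + 1 ≤ s → k s ^ 2 + k' s ^ 2 ≤ 2 * A s := by
    intro s hs
    have hs0 := hpos s hs
    have h1 : (n : ℝ) / s ≤ 1 := by rw [div_le_one hs0]; linarith
    have h0 : 0 ≤ (n : ℝ) / s := by positivity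
    have := mul_nonneg h0 (sq_nonneg (k s + k' s))
    have := mul_nonneg (sub_nonneg.2 h1) (add_nonneg (sq_nonneg (k s)) (sq_nonneg (k' s)))
    simp only [hA]
    nlinarith
  -- the derivative of `s ^ n * A s` is at most `n / s²` times `s ^ n * A s`, so the factor
  -- `exp (n / s)` makes the product decreasing
  set W : ℝ → ℝ := fun s => s ^ n * A s * Real.exp (n / s)
  have hW : ∀ s : ℝ, (n : ℝ) + 1 ≤ s → HasDerivAt W
      (-(n / s ^ 2) * s ^ n * (A s + k s * k' s) * Real.exp (n / s)) s := by
    intro s hs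
    have hs0 := hpos s hs
    have hdiv : HasDerivAt (fun s : ℝ => (n : ℝ) / s) (-(n / s ^ 2)) s := by
      have := (hasDerivAt_inv hs0.ne').const_mul (n : ℝ)
      refine (this.congr_deriv ?_)
      field_simp
    have hAd := ((((hk s).pow 2).add ((hk' s).pow 2)).add (hdiv.mul ((hk s).mul (hk' s))))
    have hd := (((hasDerivAt_pow n s).mul hAd).mul hdiv.exp)
    refine hd.congr_deriv ?_
    have hk2 : k'' s = -(n / s * k' s) - k s := by
      have := hode s
      field_simp
      linarith
    have hpow : (n : ℝ) * s ^ (n - 1) = n / s * s ^ n := by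
      rcases n with _ | m
      · simp
      · rw [Nat.add_sub_cancel, pow_succ]; field_simp
    simp only [Pi.add_apply, Pi.mul_apply, Pi.pow_apply, hk2, hA]
    rw [hpow]
    field_simp
    ring
  have hanti : AntitoneOn W (Set.Ici ((n : ℝ) + 1)) := by
    refine antitoneOn_of_hasDerivWithinAt_nonpos (convex_Ici _)
      (fun s hs => (hW s hs).continuousAt.continuousWithinAt)
      (fun s hs => (hW s (interior_subset hs)).hasDerivWithinAt) fun s hs => ?_
    have hs' : (n : ℝ) + 1 ≤ s := interior_subset hs
    have hs0 := hpos s hs'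
    have h1 : 0 ≤ A s + k s * k' s := by
      have := hcmp s hs'
      nlinarith [sq_nonneg (k s + k' s)]
    have : 0 ≤ (n / s ^ 2) * s ^ n * (A s + k s * k' s) * Real.exp (n / s) := by positivity
    linarith
  refine ⟨2 * W (n + 1), fun s hs => ?_⟩
  have hs0 := hpos s hs
  have h1 := hanti (Set.mem_Ici.2 le_rfl) (Set.mem_Ici.2 hs) hs
  have hA0 : 0 ≤ A s := by have := hcmp s hs; nlinarith [sq_nonneg (k s), sq_nonneg (k' s)]
  have h2 : s ^ n * A s ≤ W s :=
    le_mul_of_one_le_right (by positivity) (Real.one_le_exp (by positivity))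
  calc s ^ n * (k s ^ 2 + k' s ^ 2) ≤ s ^ n * (2 * A s) := by gcongr; exact hcmp s hs
    _ ≤ 2 * W (n + 1) := by linarith

theorem exists_sphK_decay (n : ℕ) : ∃ C, 0 < C ∧ ∀ s : ℝ, 0 ≤ s →
    |sphK n s| ≤ C * (1 + s) ^ (-(n : ℝ) / 2) ∧ |sphK' n s| ≤ C * (1 + s) ^ (-(n : ℝ) / 2) := by
  obtain ⟨C₀, hC₀⟩ := ode_energy_bound (hasDerivAt_sphK n) (hasDerivAt_sphK' n) (sphK_ode n)
  set M := (surf n).real Set.univ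
  have hM : 0 ≤ M := measureReal_nonneg
  set C₁ := (2 : ℝ) ^ n * |C₀| + (n + 2) ^ n * (M ^ 2 + M ^ 2) + 1
  have hC₁ : 0 < C₁ := by positivity
  have key : ∀ s : ℝ, 0 ≤ s → (1 + s) ^ n * (sphK n s ^ 2 + sphK' n s ^ 2) ≤ C₁ := by
    intro s hs
    rcases le_total ((n : ℝ) + 1) s with h | h
    · have h1 : (1 + s) ^ n ≤ 2 ^ n * s ^ n := by
        rw [← mul_pow]
        have : (0 : ℝ) ≤ n := n.cast_nonneg
        gcongr; linarith
      have h2 := (hC₀ s h).trans (le_abs_self _)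
      have h3 : (0 : ℝ) ≤ (n + 2) ^ n * (M ^ 2 + M ^ 2) := by positivity
      calc _ ≤ 2 ^ n * s ^ n * (sphK n s ^ 2 + sphK' n s ^ 2) := by gcongr
        _ = 2 ^ n * (s ^ n * (sphK n s ^ 2 + sphK' n s ^ 2)) := by ring
        _ ≤ 2 ^ n * |C₀| := by gcongr
        _ ≤ C₁ := by simp only [C₁]; linarith
    · have h1 : (1 + s) ^ n ≤ ((n : ℝ) + 2) ^ n := by gcongr ?_ ^ n; linarith
      have h2 : sphK n s ^ 2 ≤ M ^ 2 := sq_le_sq.2 ((abs_sphK_le n s).trans (le_abs_self _))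
      have h3 : sphK' n s ^ 2 ≤ M ^ 2 := sq_le_sq.2 ((abs_sphK'_le n s).trans (le_abs_self _))
      have h4 : 0 ≤ (2 : ℝ) ^ n * |C₀| := by positivity
      calc _ ≤ ((n : ℝ) + 2) ^ n * (M ^ 2 + M ^ 2) := by gcongr
        _ ≤ C₁ := by simp only [C₁]; linarith
  refine ⟨Real.sqrt C₁, Real.sqrt_pos.2 hC₁, fun s hs => ?_⟩
  have h1s : 0 < 1 + s := by linarith
  have hpw : ((1 + s) ^ (-(n : ℝ) / 2)) ^ 2 * (1 + s) ^ n = 1 := by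
    rw [← Real.rpow_natCast, ← Real.rpow_natCast, ← Real.rpow_mul h1s.le, ← Real.rpow_add h1s]
    have : -(n : ℝ) / 2 * ((2 : ℕ) : ℝ) + n = 0 := by push_cast; ring
    rw [this, Real.rpow_zero]
  have main : ∀ x : ℝ, x ^ 2 ≤ sphK n s ^ 2 + sphK' n s ^ 2 →
      |x| ≤ Real.sqrt C₁ * (1 + s) ^ (-(n : ℝ) / 2) := by
    intro x hx
    apply abs_le_of_sq_le_sq _ (by positivity)
    rw [mul_pow, Real.sq_sqrt hC₁.le]
    have h5 : (1 + s) ^ n * x ^ 2 ≤ C₁ := le_trans (by gcongr) (key s hs)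
    calc x ^ 2 = ((1 + s) ^ n * x ^ 2) * ((1 + s) ^ (-(n : ℝ) / 2)) ^ 2 := by
          linear_combination (-x ^ 2) * hpw
      _ ≤ C₁ * ((1 + s) ^ (-(n : ℝ) / 2)) ^ 2 := by gcongr
  exact ⟨main _ (by nlinarith [sq_nonneg (sphK' n s)]), main _ (by nlinarith [sq_nonneg (sphK n s)])⟩

/-! ### Polar coordinates -/

theorem lintegral_volumeIoiPow (n : ℕ) (h : ℝ → ℝ≥0∞) (hh : Measurable h) :
    ∫⁻ r : Set.Ioi (0 : ℝ), h r ∂(Measure.volumeIoiPow n) =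
      ∫⁻ r in Set.Ioi (0 : ℝ), ENNReal.ofReal (r ^ n) * h r := by
  rw [Measure.volumeIoiPow, lintegral_withDensity_eq_lintegral_mul _ (by fun_prop)
    (show Measurable fun r : Set.Ioi (0 : ℝ) => h r from hh.comp measurable_subtype_coe)]
  exact lintegral_subtype_comap measurableSet_Ioi
    (fun r : ℝ => ENNReal.ofReal (r ^ n) * h r)

theorem integral_volumeIoiPow (n : ℕ) (h : ℝ → ℂ) :
    ∫ r : Set.Ioi (0 : ℝ), h r ∂(Measure.volumeIoiPow n) =
      ∫ r in Set.Ioi (0 : ℝ), ((r ^ n : ℝ) : ℂ) * h r := by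
  simp only [Measure.volumeIoiPow, ENNReal.ofReal]
  rw [integral_withDensity_eq_integral_smul
      ((measurable_subtype_coe.pow_const _).real_toNNReal),
    integral_subtype_comap measurableSet_Ioi fun a ↦ Real.toNNReal (a ^ n) • h a,
    setIntegral_congr_fun measurableSet_Ioi fun x hx ↦ ?_]
  simp only [NNReal.smul_def, Real.coe_toNNReal _ (pow_nonneg (Set.mem_Ioi.1 hx).le _),
    Complex.real_smul]

theorem lintegral_radial {n : ℕ} (h : ℝ → ℝ≥0∞) (hh : Measurable h) :
    ∫⁻ x : EuclideanSpace ℝ (Fin (n + 1)), h ‖x‖ =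
      surf n Set.univ * ∫⁻ r in Set.Ioi (0 : ℝ), ENNReal.ofReal (r ^ n) * h r := by
  have hmp := (volume : Measure (EuclideanSpace ℝ (Fin (n + 1)))).measurePreserving_homeomorphUnitSphereProd
  have hdim : Module.finrank ℝ (EuclideanSpace ℝ (Fin (n + 1))) - 1 = n := by simp
  rw [hdim] at hmp
  calc ∫⁻ x : EuclideanSpace ℝ (Fin (n + 1)), h ‖x‖
      = ∫⁻ x : ({(0)}ᶜ : Set (EuclideanSpace ℝ (Fin (n + 1)))), h ‖x.1‖ ∂(volume.comap Subtype.val) := by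
        rw [lintegral_subtype_comap (measurableSet_singleton _).compl fun x ↦ h (‖x‖),
          restrict_compl_singleton]
    _ = ∫⁻ z, h z.2 ∂((surf n).prod (Measure.volumeIoiPow n)) := by
        rw [← hmp.lintegral_comp (by fun_prop)]
        simp
    _ = surf n Set.univ * ∫⁻ r : Set.Ioi (0 : ℝ), h r ∂(Measure.volumeIoiPow n) := by
        rw [lintegral_prod _ (by fun_prop)]
        simp [mul_comm]
    _ = _ := by rw [lintegral_volumeIoiPow n h hh]

/-- Integration in polar coordinates; the factor `r ^ n` is the Jacobian in dimension `n + 1`. -/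
theorem integral_polar {n : ℕ} {f : EuclideanSpace ℝ (Fin (n + 1)) → ℂ} (hf : Integrable f) :
    ∫ x, f x = ∫ r in Set.Ioi (0 : ℝ), ((r ^ n : ℝ) : ℂ) * ∫ ω, f (r • ω.1) ∂(surf n) := by
  have hmp := (volume : Measure (EuclideanSpace ℝ (Fin (n + 1)))).measurePreserving_homeomorphUnitSphereProd
  have hdim : Module.finrank ℝ (EuclideanSpace ℝ (Fin (n + 1))) - 1 = n := by simp
  rw [hdim] at hmp
  have hemb := (homeomorphUnitSphereProd (EuclideanSpace ℝ (Fin (n + 1)))).measurableEmbedding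
  let F : Metric.sphere (0 : EuclideanSpace ℝ (Fin (n + 1))) 1 × Set.Ioi (0 : ℝ) → ℂ :=
    fun z => f (z.2.1 • z.1.1)
  have hcomp : ∀ x : ({(0)}ᶜ : Set (EuclideanSpace ℝ (Fin (n + 1)))),
      F (homeomorphUnitSphereProd _ x) = f x := by
    intro x
    have h0 : ‖x.1‖ ≠ 0 := norm_ne_zero_iff.2 x.2
    simp [F, smul_smul, mul_inv_cancel₀ h0]
  have hint : Integrable F ((surf n).prod (Measure.volumeIoiPow n)) := by
    rw [← hmp.integrable_comp_emb hemb]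
    have : F ∘ (homeomorphUnitSphereProd (EuclideanSpace ℝ (Fin (n + 1)))) = f ∘ (↑) :=
      funext hcomp
    rw [this, ← integrableOn_iff_comap_subtypeVal (measurableSet_singleton _).compl]
    exact hf.integrableOn
  calc ∫ x, f x
      = ∫ x : ({(0)}ᶜ : Set (EuclideanSpace ℝ (Fin (n + 1)))), f x ∂(volume.comap Subtype.val) := by
        rw [integral_subtype_comap (measurableSet_singleton _).compl f,
          restrict_compl_singleton]
    _ = ∫ z, F z ∂((surf n).prod (Measure.volumeIoiPow n)) := by
        rw [← hmp.integral_comp hemb]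
        simp_rw [hcomp]
    _ = ∫ r : Set.Ioi (0 : ℝ), (∫ ω, f (r.1 • ω.1) ∂(surf n)) ∂(Measure.volumeIoiPow n) :=
        integral_prod_symm F hint
    _ = _ := integral_volumeIoiPow n (fun r => ∫ ω, f (r • ω.1) ∂(surf n))

/-! ### Radial functions and their Fourier transforms -/

theorem integral_surf_cos_inner {n : ℕ} (y : EuclideanSpace ℝ (Fin (n + 1))) :
    ∫ ω, Real.cos (inner ℝ y ω.1) ∂(surf n) = sphK n ‖y‖ := by
  have h : ‖y‖ = ‖EuclideanSpace.single (0 : Fin (n + 1)) ‖y‖‖ := by simp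
  rw [integral_surf_inner_eq_of_norm_eq Real.cos h, sphK]
  simp [EuclideanSpace.inner_single_left]

theorem integral_surf_exp_inner {n : ℕ} (y : EuclideanSpace ℝ (Fin (n + 1))) :
    ∫ ω, Complex.exp (((inner ℝ y ω.1 : ℝ) : ℂ) * Complex.I) ∂(surf n) = (sphK n ‖y‖ : ℂ) := by
  have hsin : ∫ ω, Real.sin (inner ℝ y ω.1) ∂(surf n) = 0 := by
    have h := integral_surf_inner_eq_of_norm_eq Real.sin (norm_neg y)
    simp only [inner_neg_left, Real.sin_neg, integral_neg] at h
    linarith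
  have hc : ∫ ω, ((Real.cos (inner ℝ y ω.1) : ℝ) : ℂ) ∂(surf n) = (sphK n ‖y‖ : ℂ) := by
    rw [integral_complex_ofReal, integral_surf_cos_inner]
  have hs : ∫ ω, ((Real.sin (inner ℝ y ω.1) : ℝ) : ℂ) ∂(surf n) = 0 := by
    rw [integral_complex_ofReal, hsin, Complex.ofReal_zero]
  simp_rw [Complex.exp_mul_I, ← Complex.ofReal_cos, ← Complex.ofReal_sin]
  have hic : Integrable (fun ω : Metric.sphere (0 : EuclideanSpace ℝ (Fin (n + 1))) 1 =>
      Real.cos (inner ℝ y ω.1)) (surf n) := integrable_surf (by fun_prop)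
  have his : Integrable (fun ω : Metric.sphere (0 : EuclideanSpace ℝ (Fin (n + 1))) 1 =>
      Real.sin (inner ℝ y ω.1)) (surf n) := integrable_surf (by fun_prop)
  rw [integral_add hic.ofReal (his.ofReal.mul_const _), integral_mul_const, hc, hs]
  simp

/-- The inverse Fourier transform of a radial function as a one-dimensional integral. -/
theorem fourierInv_radial {n : ℕ} {H : ℝ → ℂ}
    (hH : Integrable fun η : EuclideanSpace ℝ (Fin (n + 1)) => H ‖η‖)
    (x : EuclideanSpace ℝ (Fin (n + 1))) :
    𝓕⁻ (fun η : EuclideanSpace ℝ (Fin (n + 1)) => H ‖η‖) x =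
      ∫ r in Set.Ioi (0 : ℝ), ((r ^ n : ℝ) : ℂ) * (H r * (sphK n (r * (2 * Real.pi * ‖x‖)) : ℂ)) := by
  rw [Real.fourierInv_eq']
  have hint : Integrable fun v : EuclideanSpace ℝ (Fin (n + 1)) =>
      Complex.exp ((↑(2 * Real.pi * inner ℝ v x) * Complex.I)) • H ‖v‖ := by
    have hc : Continuous fun v : EuclideanSpace ℝ (Fin (n + 1)) =>
        Complex.exp ((↑(2 * Real.pi * inner ℝ v x) * Complex.I)) := by fun_prop
    refine hH.mono (hc.aestronglyMeasurable.smul hH.1) (.of_forall fun v => ?_)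
    rw [norm_smul, Complex.norm_exp_ofReal_mul_I, one_mul]
  rw [integral_polar hint]
  refine setIntegral_congr_fun measurableSet_Ioi fun r hr => ?_
  have hr0 : (0 : ℝ) < r := hr
  have h1 : ∀ ω : Metric.sphere (0 : EuclideanSpace ℝ (Fin (n + 1))) 1,
      Complex.exp ((↑(2 * Real.pi * inner ℝ (r • ω.1) x) * Complex.I)) • H ‖r • ω.1‖ =
      Complex.exp (((inner ℝ ((r * (2 * Real.pi)) • x) ω.1 : ℝ) : ℂ) * Complex.I) * H r := by
    intro ω
    rw [norm_smul, norm_eq_of_mem_sphere, mul_one, Real.norm_of_nonneg hr0.le, smul_eq_mul,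
      real_inner_smul_left, real_inner_smul_left, real_inner_comm]
    ring_nf
  congr 1
  simp_rw [h1]
  rw [integral_mul_const, integral_surf_exp_inner, norm_smul, Real.norm_of_nonneg (by positivity)]
  ring_nf

theorem fourier_eq_of_norm_eq {n : ℕ} {h : ℝ → ℂ} {ξ ζ : EuclideanSpace ℝ (Fin (n + 1))}
    (hn : ‖ξ‖ = ‖ζ‖) :
    𝓕 (fun x : EuclideanSpace ℝ (Fin (n + 1)) => h ‖x‖) ξ =
      𝓕 (fun x : EuclideanSpace ℝ (Fin (n + 1)) => h ‖x‖) ζ := by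
  have hL := Submodule.reflection_sub hn
  rw [← hL, ← Real.fourier_comp_linearIsometry]
  have : (fun x : EuclideanSpace ℝ (Fin (n + 1)) => h ‖x‖) ∘
      (Submodule.reflection (ℝ ∙ (ξ - ζ))ᗮ) = fun x => h ‖x‖ := by
    funext x
    simp
  rw [this]

/-- The Plancherel transform preserves radial functions: truncations to balls are in `L¹`, their
Fourier integrals are exactly radial, and a subsequence converges almost everywhere. -/
theorem IsRadial.fourier {n : ℕ} {f : L2 (n + 1)} (hf : IsRadial f) :
    IsRadial (𝓕 f : L2 (n + 1)) := by
  obtain ⟨g, hg, hfg⟩ := hf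
  set h : ℕ → ℝ → ℂ := fun m => (Set.Iic (m : ℝ)).indicator g with hh
  have hgL : MemLp (fun x : EuclideanSpace ℝ (Fin (n + 1)) => g ‖x‖) 2 volume :=
    (memLp_congr_ae hfg).1 (Lp.memLp f)
  have hind : ∀ m, (fun x : EuclideanSpace ℝ (Fin (n + 1)) => h m ‖x‖) =
      (Metric.closedBall 0 (m : ℝ)).indicator (fun x => g ‖x‖) := by
    intro m
    ext x
    by_cases hx : ‖x‖ ≤ (m : ℝ)
    · rw [Set.indicator_of_mem (mem_closedBall_zero_iff.2 hx)]
      simp [h, hx]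
    · rw [Set.indicator_of_notMem (by rwa [mem_closedBall_zero_iff])]
      simp [h, hx]
  have hhL : ∀ m, MemLp (fun x : EuclideanSpace ℝ (Fin (n + 1)) => h m ‖x‖) 2 volume := by
    intro m
    rw [hind]
    exact hgL.indicator Metric.isClosed_closedBall.measurableSet
  have hhI : ∀ m, Integrable (fun x : EuclideanSpace ℝ (Fin (n + 1)) => h m ‖x‖) volume := by
    intro m
    rw [hind, integrable_indicator_iff Metric.isClosed_closedBall.measurableSet]
    have : IsFiniteMeasure (volume.restrict
        (Metric.closedBall (0 : EuclideanSpace ℝ (Fin (n + 1))) (m : ℝ))) :=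
      ⟨by simpa using measure_closedBall_lt_top⟩
    exact (hgL.restrict _).integrable (by norm_num)
  have hf' : f = hgL.toLp _ := by
    apply Lp.ext
    filter_upwards [hfg, hgL.coeFn_toLp] with x h1 h2
    rw [h1, h2]
  have hconv : Filter.Tendsto (fun m => (hhL m).toLp _) Filter.atTop (nhds f) := by
    rw [hf', Lp.tendsto_Lp_iff_tendsto_eLpNorm'']
    have hfin : ∫⁻ x : EuclideanSpace ℝ (Fin (n + 1)), ‖g ‖x‖‖ₑ ^ (2 : ℝ) ≠ ∞ := by
      have := hgL.2
      rw [eLpNorm_lt_top_iff_lintegral_rpow_enorm_lt_top (by norm_num) (by norm_num)] at this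
      simpa using this.ne
    have key : Filter.Tendsto (fun m => ∫⁻ x : EuclideanSpace ℝ (Fin (n + 1)),
        ‖h m ‖x‖ - g ‖x‖‖ₑ ^ (2 : ℝ)) Filter.atTop (nhds 0) := by
      have := tendsto_lintegral_of_dominated_convergence'
        (μ := (volume : Measure (EuclideanSpace ℝ (Fin (n + 1)))))
        (F := fun m x => ‖h m ‖x‖ - g ‖x‖‖ₑ ^ (2 : ℝ)) (f := fun _ => 0)
        (fun x => ‖g ‖x‖‖ₑ ^ (2 : ℝ)) (fun m => by
          have := ((hhL m).1.sub hgL.1).enorm.pow_const (2 : ℝ)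
          exact this)
        (fun m => .of_forall fun x => by
          by_cases hx : ‖x‖ ≤ (m : ℝ) <;> simp [h, hx]) hfin
        (.of_forall fun x => by
          obtain ⟨m₀, hm₀⟩ := exists_nat_ge ‖x‖
          refine tendsto_const_nhds.congr' ?_
          filter_upwards [Filter.eventually_ge_atTop m₀] with m hm
          have : ‖x‖ ≤ (m : ℝ) := hm₀.trans (by exact_mod_cast hm)
          simp [h, this])
      simpa using this
    have h2 := key.ennrpow_const (1 / 2)
    simp only [one_div, ENNReal.zero_rpow_of_pos (show (0 : ℝ) < 2⁻¹ by norm_num)] at h2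
    refine h2.congr fun m => ?_
    rw [eLpNorm_eq_lintegral_rpow_enorm_toReal (by norm_num) (by norm_num)]
    simp
  have hconv' : Filter.Tendsto (fun m => (𝓕 ((hhL m).toLp _) : L2 (n + 1))) Filter.atTop
      (nhds (𝓕 f : L2 (n + 1))) :=
    ((Lp.fourierTransformₗᵢ (EuclideanSpace ℝ (Fin (n + 1))) ℂ).continuous.tendsto f).comp hconv
  obtain ⟨φ, -, hφ⟩ := (tendstoInMeasure_of_tendsto_Lp hconv').exists_seq_tendsto_ae
  set G : ℕ → ℝ → ℂ := fun m ρ =>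
    𝓕 (fun x : EuclideanSpace ℝ (Fin (n + 1)) => h (φ m) ‖x‖) (EuclideanSpace.single 0 ρ)
  have hG : ∀ m, Continuous (G m) := by
    intro m
    refine (continuous_fourier (hhI (φ m))).comp ?_
    exact (PiLp.continuous_toLp 2 _).comp (continuous_single (A := fun _ => ℝ) (0 : Fin (n + 1)))
  refine ⟨fun ρ => limUnder Filter.atTop fun m => G m ρ,
    (StronglyMeasurable.limUnder fun m => (hG m).stronglyMeasurable).measurable, ?_⟩
  have hae : ∀ᵐ ξ, ∀ m, (𝓕 ((hhL (φ m)).toLp _) : L2 (n + 1)) ξ = G m ‖ξ‖ := by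
    rw [ae_all_iff]
    intro m
    filter_upwards [fourier_toLp_ae_eq (hhL (φ m)) (hhI (φ m))] with ξ hξ
    rw [hξ]
    exact fourier_eq_of_norm_eq (by simp)
  filter_upwards [hφ, hae] with ξ h1 h2
  simp_rw [h2] at h1
  exact h1.limUnder_eq.symm

theorem eLpNorm_two_rpow {X : Type*} [MeasurableSpace X] (μ : Measure X) (f : X → ℂ) :
    eLpNorm f 2 μ ^ (2 : ℝ) = ∫⁻ x, ‖f x‖ₑ ^ (2 : ℝ) ∂μ := by
  rw [eLpNorm_eq_lintegral_rpow_enorm_toReal (by norm_num) (by norm_num), ← ENNReal.rpow_mul]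
  simp

theorem ae_comp_smul {n : ℕ} {c : ℝ} (hc : c ≠ 0) {P : EuclideanSpace ℝ (Fin (n + 1)) → Prop}
    (h : ∀ᵐ x, P x) : ∀ᵐ x, P (c • x) := by
  rw [ae_iff] at h ⊢
  have := Measure.addHaar_preimage_smul (volume : Measure (EuclideanSpace ℝ (Fin (n + 1)))) hc
    {x | ¬ P x}
  rw [h, mul_zero] at this
  exact this

/-- The half-wave evolution of a radial function with frequencies in `I` is a one-dimensional
oscillatory integral with kernel `sphK`. The profile `m` contains the Jacobian `ρ ^ n`, and the
frequency is `2πρ` because `ρ` is the variable of the transform `𝓕`. -/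
theorem exists_profile {n : ℕ} {f : L2 (n + 1)} (hf : IsRadial f) {I : Set ℝ}
    (hI : I.OrdConnected) (hI2 : I ⊆ Set.Icc (1 / 2) 2)
    (hs : ∀ᵐ ξ : EuclideanSpace ℝ (Fin (n + 1)), ‖ξ‖ ∉ I → hat f ξ = 0) :
    ∃ m : ℝ → ℂ, Measurable m ∧ (∀ ρ, 2 * Real.pi * ρ ∉ I → m ρ = 0) ∧
      surf n Set.univ * ∫⁻ ρ, ‖m ρ‖ₑ ^ (2 : ℝ) ≤ ‖f‖ₑ ^ (2 : ℝ) ∧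
      ∀ t : ℝ, halfWave t f =ᵐ[volume] fun x => ∫ ρ, m ρ *
        (Complex.exp (((t * (2 * Real.pi * ρ) : ℝ) : ℂ) * Complex.I) *
          (sphK n (ρ * (2 * Real.pi * ‖x‖)) : ℂ)) := by
  obtain ⟨G, hG, hFG⟩ := hf.fourier
  set J : Set ℝ := {ρ | 2 * Real.pi * ρ ∈ I} with hJ
  have hJm : MeasurableSet J := hI.measurableSet.preimage (by fun_prop)
  have hJ2 : ∀ ρ ∈ J, 0 < ρ ∧ ρ ≤ 1 := by
    intro ρ hρ
    obtain ⟨h1, h2⟩ := hI2 (show 2 * Real.pi * ρ ∈ I from hρ)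
    have := Real.pi_gt_three
    constructor <;> nlinarith
  set H : ℝ → ℂ := J.indicator G with hH
  have hHm : Measurable H := hG.indicator hJm
  have hFH : ∀ᵐ η : EuclideanSpace ℝ (Fin (n + 1)), (𝓕 f : L2 (n + 1)) η = H ‖η‖ := by
    have h2 := ae_comp_smul (n := n) (c := 2 * Real.pi) (by positivity) hs
    filter_upwards [hFG, h2] with η h1 h2
    by_cases hη : ‖η‖ ∈ J
    · rw [h1, hH, Set.indicator_of_mem hη]
    · rw [hH, Set.indicator_of_notMem hη]
      have hn : ‖(2 * Real.pi) • η‖ = 2 * Real.pi * ‖η‖ := by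
        rw [norm_smul, Real.norm_of_nonneg (by positivity)]
      have h3 := h2 (by rw [hn]; exact hη)
      rw [hat, smul_smul, inv_mul_cancel₀ (by positivity), one_smul] at h3
      refine (mul_eq_zero.1 h3).resolve_left ?_
      exact_mod_cast (Real.rpow_pos_of_pos (by positivity) _).ne'
  refine ⟨fun ρ => ((ρ ^ n : ℝ) : ℂ) * H ρ, by fun_prop, fun ρ hρ => ?_, ?_, fun t => ?_⟩
  · have : ρ ∉ J := hρ
    simp [hH, this]
  · have h1 : ‖f‖ₑ ^ (2 : ℝ) = ∫⁻ η : EuclideanSpace ℝ (Fin (n + 1)), ‖H ‖η‖‖ₑ ^ (2 : ℝ) := by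
      rw [← eLpNorm_two_rpow volume fun η : EuclideanSpace ℝ (Fin (n + 1)) => H ‖η‖,
        ← eLpNorm_congr_ae hFH, ← Lp.enorm_def, ← ofReal_norm, ← ofReal_norm, Lp.norm_fourier_eq]
    rw [h1, lintegral_radial (fun ρ => ‖H ρ‖ₑ ^ (2 : ℝ)) (by fun_prop)]
    refine mul_le_mul' le_rfl ?_
    rw [← lintegral_indicator measurableSet_Ioi]
    refine lintegral_mono fun ρ => ?_
    by_cases hρ : ρ ∈ J
    · obtain ⟨h0, h1⟩ := hJ2 ρ hρ
      rw [Set.indicator_of_mem (Set.mem_Ioi.2 h0), enorm_mul,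
        ENNReal.mul_rpow_of_nonneg _ _ (by norm_num)]
      gcongr
      have h3 : ‖((ρ ^ n : ℝ) : ℂ)‖ₑ = ENNReal.ofReal (ρ ^ n) := by
        rw [← ofReal_norm, Complex.norm_real, Real.norm_of_nonneg (by positivity)]
      rw [h3]
      have h4 : ENNReal.ofReal (ρ ^ n) ≤ 1 := by
        rw [ENNReal.ofReal_le_one]; exact pow_le_one₀ h0.le h1
      -- one of the two Jacobian factors in `‖m‖²` is discarded, as `ρ ≤ 1`
      calc ENNReal.ofReal (ρ ^ n) ^ (2 : ℝ) ≤ ENNReal.ofReal (ρ ^ n) ^ (1 : ℝ) :=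
            ENNReal.rpow_le_rpow_of_exponent_ge h4 (by norm_num)
        _ = _ := ENNReal.rpow_one _
    · simp [hH, hρ]
  · set Ht : ℝ → ℂ := fun ρ =>
      Complex.exp (((t * (2 * Real.pi * ρ) : ℝ) : ℂ) * Complex.I) * H ρ with hHt
    have hae : (fun η : EuclideanSpace ℝ (Fin (n + 1)) =>
        Complex.exp (((t * (2 * Real.pi * ‖η‖) : ℝ) : ℂ) * Complex.I) * (𝓕 f : L2 (n + 1)) η)
        =ᵐ[volume] fun η => Ht ‖η‖ := by
      filter_upwards [hFH] with η h
      rw [h]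
    have hL : MemLp (fun η : EuclideanSpace ℝ (Fin (n + 1)) => Ht ‖η‖) 2 volume :=
      (memLp_congr_ae hae).1 (memLp_phase t (𝓕 f : L2 (n + 1)))
    have hLI : Integrable (fun η : EuclideanSpace ℝ (Fin (n + 1)) => Ht ‖η‖) volume := by
      have : IsFiniteMeasure (volume.restrict
          (Metric.closedBall (0 : EuclideanSpace ℝ (Fin (n + 1))) 1)) :=
        ⟨by simpa using measure_closedBall_lt_top⟩
      have hon : IntegrableOn (fun η : EuclideanSpace ℝ (Fin (n + 1)) => Ht ‖η‖)
          (Metric.closedBall 0 1) volume := (hL.restrict _).integrable (by norm_num)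
      refine hon.integrable_of_forall_notMem_eq_zero fun η hη => ?_
      have : ‖η‖ ∉ J := fun h => hη (mem_closedBall_zero_iff.2 (hJ2 _ h).2)
      simp [hHt, hH, this]
    have heq : halfWave t f = 𝓕⁻ (hL.toLp _ : L2 (n + 1)) := by
      rw [halfWave]
      congr 1
      exact (MemLp.toLp_eq_toLp_iff _ _).2 hae
    rw [heq]
    filter_upwards [fourierInv_toLp_ae_eq hL hLI] with x hx
    rw [hx, fourierInv_radial hLI]
    rw [setIntegral_eq_integral_of_forall_compl_eq_zero]
    · refine integral_congr_ae (.of_forall fun ρ => ?_)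
      simp only [hHt]
      ring
    · intro ρ hρ
      have : ρ ∉ J := fun h => hρ (hJ2 _ h).1
      simp [hHt, hH, this]

/-! ### One-dimensional estimates for the wave profile -/

theorem lintegral_rpow_two_le {X : Type*} [MeasurableSpace X] {μ : Measure X} {f : X → ℝ≥0∞}
    (hf : AEMeasurable f μ) :
    (∫⁻ x, f x ∂μ) ^ (2 : ℝ) ≤ μ Set.univ * ∫⁻ x, f x ^ (2 : ℝ) ∂μ := by
  have h := ENNReal.lintegral_mul_le_Lp_mul_Lq μ (p := 2) (q := 2)
    (Real.holderConjugate_iff.2 (by norm_num)) (f := fun _ => 1) (g := f) aemeasurable_const hf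
  simp only [Pi.mul_apply, one_mul, ENNReal.one_rpow, lintegral_const] at h
  refine (ENNReal.rpow_le_rpow h (show (0 : ℝ) ≤ 2 by norm_num)).trans ?_
  rw [ENNReal.mul_rpow_of_nonneg _ _ (by norm_num), ← ENNReal.rpow_mul, ← ENNReal.rpow_mul]
  norm_num

/-- Cauchy-Schwarz bound for the Fourier integral of a function supported in `J`. -/
theorem enorm_integral_mul_le {w e : ℝ → ℂ} {J : Set ℝ} (hJ : MeasurableSet J) (hw : Measurable w)
    (hwJ : ∀ ρ, ρ ∉ J → w ρ = 0) (he : ∀ ρ, ‖e ρ‖ₑ ≤ 1) :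
    ‖∫ ρ, w ρ * e ρ‖ₑ ≤ volume J ^ (1 / 2 : ℝ) * (∫⁻ ρ, ‖w ρ‖ₑ ^ (2 : ℝ)) ^ (1 / 2 : ℝ) := by
  have h1 : ‖∫ ρ, w ρ * e ρ‖ₑ ≤ ∫⁻ ρ in J, ‖w ρ‖ₑ := by
    refine (enorm_integral_le_lintegral_enorm _).trans ?_
    rw [← lintegral_indicator hJ]
    refine lintegral_mono fun ρ => ?_
    by_cases hρ : ρ ∈ J
    · rw [Set.indicator_of_mem hρ, enorm_mul]
      exact mul_le_of_le_one_right' (he ρ)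
    · simp [hwJ ρ hρ]
  have h2 := lintegral_rpow_two_le (μ := volume.restrict J) hw.enorm.aemeasurable
  rw [Measure.restrict_apply_univ] at h2
  have h3 := ENNReal.rpow_le_rpow (h2.trans (mul_le_mul' le_rfl (setLIntegral_le_lintegral J _)))
    (show (0 : ℝ) ≤ 1 / 2 by norm_num)
  rw [← ENNReal.rpow_mul, ENNReal.mul_rpow_of_nonneg _ _ (by norm_num)] at h3
  norm_num at h3 ⊢
  exact h1.trans h3

/-- Plancherel in time. -/
theorem lintegral_fourier_profile {w : ℝ → ℂ} {J : Set ℝ} (hw : Measurable w)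
    (hwJ : ∀ ρ, ρ ∉ J → w ρ = 0) (hJ : volume J ≠ ∞) (hw2 : ∫⁻ ρ, ‖w ρ‖ₑ ^ (2 : ℝ) ≠ ∞) :
    ∫⁻ t : ℝ, ‖∫ ρ, w ρ * Complex.exp (((t * (2 * Real.pi * ρ) : ℝ) : ℂ) * Complex.I)‖ₑ ^ (2 : ℝ)
      = ∫⁻ ρ, ‖w ρ‖ₑ ^ (2 : ℝ) := by
  have hL : MemLp w 2 volume := by
    refine ⟨hw.aestronglyMeasurable, ?_⟩
    rw [eLpNorm_lt_top_iff_lintegral_rpow_enorm_lt_top (by norm_num) (by norm_num)]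
    simpa using hw2.lt_top
  have hI : Integrable w volume := by
    have : IsFiniteMeasure (volume.restrict J) := ⟨by simpa using hJ.lt_top⟩
    have hon : IntegrableOn w J volume := (hL.restrict _).integrable (by norm_num)
    exact hon.integrable_of_forall_notMem_eq_zero hwJ
  have h := congrArg (· ^ (2 : ℝ)) (eLpNorm_fourierInv hL hI)
  simp only [eLpNorm_two_rpow] at h
  rw [← h]
  refine lintegral_congr fun t => ?_
  rw [Real.fourierInv_eq']
  congr 2
  refine integral_congr_ae (.of_forall fun ρ => ?_)
  simp only [smul_eq_mul, mul_comm (w ρ)]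
  congr 4
  simp
  ring

/-- A function is controlled on a unit interval by the averages of itself and its derivative. -/
theorem enorm_le_lintegral_add_deriv {u v : ℝ → ℂ} (hu : ∀ s, HasDerivAt u (v s) s)
    (hv : Continuous v) {a r : ℝ} (hr : r ∈ Set.Icc a (a + 1)) :
    ‖u r‖ₑ ≤ ∫⁻ s in Set.Icc a (a + 1), (‖u s‖ₑ + ‖v s‖ₑ) := by
  have huc : Continuous u := continuous_iff_continuousAt.2 fun s => (hu s).continuousAt
  have h1 : ∀ s ∈ Set.Icc a (a + 1),
      ‖u r‖ₑ ≤ ‖u s‖ₑ + ∫⁻ s in Set.Icc a (a + 1), ‖v s‖ₑ := by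
    intro s hs
    have h2 : ∫ y in s..r, v y = u r - u s :=
      intervalIntegral.integral_eq_sub_of_hasDerivAt (fun y _ => hu y) (hv.intervalIntegrable _ _)
    have h3 : ‖u r - u s‖ₑ ≤ ∫⁻ s in Set.Icc a (a + 1), ‖v s‖ₑ := by
      rw [← h2, ← ofReal_norm, intervalIntegral.norm_integral_eq_norm_integral_uIoc, ofReal_norm]
      refine (enorm_integral_le_lintegral_enorm _).trans (lintegral_mono_set ?_)
      exact Set.uIoc_subset_uIcc.trans (Set.uIcc_subset_Icc hs hr)
    calc ‖u r‖ₑ = ‖u s + (u r - u s)‖ₑ := by congr 1; ring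
      _ ≤ ‖u s‖ₑ + ‖u r - u s‖ₑ := enorm_add_le _ _
      _ ≤ _ := by gcongr
  have hvol : volume (Set.Icc a (a + 1)) = 1 := by simp
  calc ‖u r‖ₑ = ∫⁻ _ in Set.Icc a (a + 1), ‖u r‖ₑ := by simp
    _ ≤ ∫⁻ s in Set.Icc a (a + 1), (‖u s‖ₑ + ∫⁻ s in Set.Icc a (a + 1), ‖v s‖ₑ) :=
        setLIntegral_mono (by fun_prop) h1
    _ = _ := by
        rw [lintegral_add_left (by fun_prop), lintegral_add_left (by fun_prop)]
        simp

/-- The profile of a radial half-wave at time `t` and radius `r`. -/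
noncomputable def waveU (n : ℕ) (m : ℝ → ℂ) (t r : ℝ) : ℂ :=
  ∫ ρ, m ρ * (Complex.exp (((t * (2 * Real.pi * ρ) : ℝ) : ℂ) * Complex.I) *
    (sphK n (ρ * (2 * Real.pi * r)) : ℂ))

/-- The radial derivative of `waveU`. -/
noncomputable def waveV (n : ℕ) (m : ℝ → ℂ) (t r : ℝ) : ℂ :=
  ∫ ρ, m ρ * (Complex.exp (((t * (2 * Real.pi * ρ) : ℝ) : ℂ) * Complex.I) *
    ((ρ * (2 * Real.pi) * sphK' n (ρ * (2 * Real.pi * r)) : ℝ) : ℂ))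

theorem continuous_sphK (n : ℕ) : Continuous (sphK n) :=
  continuous_iff_continuousAt.2 fun s => (hasDerivAt_sphK n s).continuousAt

theorem continuous_sphK' (n : ℕ) : Continuous (sphK' n) :=
  continuous_iff_continuousAt.2 fun s => (hasDerivAt_sphK' n s).continuousAt

/-- Standing assumptions on a profile: it is square integrable, and its frequencies `2πρ` lie in
`[1/2, 2]` and fill a set of measure at most `δ`. -/
structure IsProfile (m : ℝ → ℂ) (J : Set ℝ) (δ : ℝ≥0∞) : Prop where
  meas : Measurable m
  measJ : MeasurableSet J
  zero : ∀ ρ, ρ ∉ J → m ρ = 0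
  freq : ∀ ρ ∈ J, 1 / 2 ≤ ρ * (2 * Real.pi) ∧ ρ * (2 * Real.pi) ≤ 2
  vol : volume J ≤ δ
  le_one : δ ≤ 1
  sq : ∫⁻ ρ, ‖m ρ‖ₑ ^ (2 : ℝ) ≠ ∞

section Profile

variable {n : ℕ} {m : ℝ → ℂ} {J : Set ℝ} {δ : ℝ≥0∞}

theorem IsProfile.integrable (h : IsProfile m J δ) : Integrable m := by
  have hL : MemLp m 2 volume := by
    refine ⟨h.meas.aestronglyMeasurable, ?_⟩
    rw [eLpNorm_lt_top_iff_lintegral_rpow_enorm_lt_top (by norm_num) (by norm_num)]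
    simpa using h.sq.lt_top
  have : IsFiniteMeasure (volume.restrict J) :=
    ⟨by simpa using (h.vol.trans h.le_one).trans_lt ENNReal.one_lt_top⟩
  have hon : IntegrableOn m J volume := (hL.restrict _).integrable (by norm_num)
  exact hon.integrable_of_forall_notMem_eq_zero h.zero

theorem norm_mul_exp_mul_le (z : ℂ) (θ c B : ℝ) (h : z ≠ 0 → |c| ≤ B) :
    ‖z * (Complex.exp ((θ : ℂ) * Complex.I) * (c : ℂ))‖ ≤ B * ‖z‖ := by
  rcases eq_or_ne z 0 with rfl | hz
  · simp
  · rw [norm_mul, norm_mul, Complex.norm_exp_ofReal_mul_I, one_mul, Complex.norm_real, mul_comm]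
    exact mul_le_mul_of_nonneg_right (h hz) (norm_nonneg _)

theorem IsProfile.mem (h : IsProfile m J δ) {ρ : ℝ} (hρ : m ρ ≠ 0) :
    1 / 2 ≤ ρ * (2 * Real.pi) ∧ ρ * (2 * Real.pi) ≤ 2 :=
  h.freq ρ (by by_contra hc; exact hρ (h.zero ρ hc))

theorem IsProfile.abs_deriv_kernel_le (h : IsProfile m J δ) {ρ : ℝ} (hρ : m ρ ≠ 0) (x : ℝ) :
    |ρ * (2 * Real.pi) * sphK' n x| ≤ 2 * (surf n).real Set.univ := by
  obtain ⟨h1, h2⟩ := h.mem hρ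
  rw [abs_mul, abs_of_nonneg (by linarith : 0 ≤ ρ * (2 * Real.pi))]
  exact mul_le_mul h2 (abs_sphK'_le n _) (abs_nonneg _) (by norm_num)

theorem IsProfile.continuous_waveU (h : IsProfile m J δ) :
    Continuous fun z : ℝ × ℝ => waveU n m z.1 z.2 := by
  have hk := continuous_sphK n
  have hm := h.meas
  refine continuous_of_dominated (bound := fun ρ => (surf n).real Set.univ * ‖m ρ‖) ?_ ?_ ?_ ?_
  · exact fun z => Measurable.aestronglyMeasurable (by fun_prop)
  · exact fun z => .of_forall fun ρ => norm_mul_exp_mul_le _ _ _ _ fun _ => abs_sphK_le n _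
  · exact h.integrable.norm.const_mul _
  · exact .of_forall fun ρ => by fun_prop

theorem IsProfile.continuous_waveV (h : IsProfile m J δ) :
    Continuous fun z : ℝ × ℝ => waveV n m z.1 z.2 := by
  have hk := continuous_sphK' n
  have hm := h.meas
  refine continuous_of_dominated (bound := fun ρ => 2 * (surf n).real Set.univ * ‖m ρ‖)
    ?_ ?_ ?_ ?_
  · exact fun z => Measurable.aestronglyMeasurable (by fun_prop)
  · exact fun z => .of_forall fun ρ => norm_mul_exp_mul_le _ _ _ _ fun hρ =>
      h.abs_deriv_kernel_le hρ _
  · exact h.integrable.norm.const_mul _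
  · exact .of_forall fun ρ => by fun_prop

theorem IsProfile.hasDerivAt_waveU (h : IsProfile m J δ) (t r : ℝ) :
    HasDerivAt (waveU n m t) (waveV n m t r) r := by
  have hk := continuous_sphK n
  have hk' := continuous_sphK' n
  have hm := h.meas
  refine (hasDerivAt_integral_of_dominated_loc_of_deriv_le
    (bound := fun ρ => 2 * (surf n).real Set.univ * ‖m ρ‖) (s := Set.univ)
    (F := fun r ρ => m ρ * (Complex.exp (((t * (2 * Real.pi * ρ) : ℝ) : ℂ) * Complex.I) *
    (sphK n (ρ * (2 * Real.pi * r)) : ℂ)))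
    (F' := fun r ρ => m ρ * (Complex.exp (((t * (2 * Real.pi * ρ) : ℝ) : ℂ) * Complex.I) *
    ((ρ * (2 * Real.pi) * sphK' n (ρ * (2 * Real.pi * r)) : ℝ) : ℂ))) Filter.univ_mem ?_ ?_ ?_ ?_ ?_ ?_).2
  · exact .of_forall fun r => Measurable.aestronglyMeasurable (by fun_prop)
  · refine (h.integrable.norm.const_mul ((surf n).real Set.univ)).mono'
      (Measurable.aestronglyMeasurable (by fun_prop)) (.of_forall fun ρ => ?_)
    exact norm_mul_exp_mul_le _ _ _ _ fun _ => abs_sphK_le n _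
  · exact Measurable.aestronglyMeasurable (by fun_prop)
  · exact .of_forall fun ρ r _ => norm_mul_exp_mul_le _ _ _ _ fun hρ =>
      h.abs_deriv_kernel_le hρ _
  · exact h.integrable.norm.const_mul _
  · refine .of_forall fun ρ r _ => ?_
    have h1 : HasDerivAt (fun r : ℝ => ρ * (2 * Real.pi * r)) (ρ * (2 * Real.pi)) r := by
      have := ((hasDerivAt_id r).const_mul (2 * Real.pi)).const_mul ρ
      simpa using this
    have h2 := ((hasDerivAt_sphK n _).comp r h1).ofReal_comp
    have h3 := (h2.const_mul
      (Complex.exp (((t * (2 * Real.pi * ρ) : ℝ) : ℂ) * Complex.I))).const_mul (m ρ)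
    refine h3.congr_deriv ?_
    rw [mul_comm (sphK' n _)]

/-- Both the uniform and the mean square bound in time for oscillatory integrals with a bounded
amplitude `c`. -/
theorem IsProfile.wave_bounds (h : IsProfile m J δ) {c : ℝ → ℝ} (hc : Continuous c) {B : ℝ}
    (hB : ∀ ρ ∈ J, |c ρ| ≤ B) :
    (∀ t : ℝ, ‖∫ ρ, m ρ * (Complex.exp (((t * (2 * Real.pi * ρ) : ℝ) : ℂ) * Complex.I) *
        (c ρ : ℂ))‖ₑ ≤
      ENNReal.ofReal B * δ ^ (1 / 2 : ℝ) * (∫⁻ ρ, ‖m ρ‖ₑ ^ (2 : ℝ)) ^ (1 / 2 : ℝ)) ∧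
    ∫⁻ t : ℝ, ‖∫ ρ, m ρ * (Complex.exp (((t * (2 * Real.pi * ρ) : ℝ) : ℂ) * Complex.I) *
        (c ρ : ℂ))‖ₑ ^ (2 : ℝ) ≤ ENNReal.ofReal B ^ (2 : ℝ) * ∫⁻ ρ, ‖m ρ‖ₑ ^ (2 : ℝ) := by
  have hm := h.meas
  set w : ℝ → ℂ := fun ρ => m ρ * (c ρ : ℂ) with hw
  have hwm : Measurable w := by fun_prop
  have hwJ : ∀ ρ, ρ ∉ J → w ρ = 0 := fun ρ hρ => by simp [hw, h.zero ρ hρ]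
  have hw2 : ∫⁻ ρ, ‖w ρ‖ₑ ^ (2 : ℝ) ≤ ENNReal.ofReal B ^ (2 : ℝ) * ∫⁻ ρ, ‖m ρ‖ₑ ^ (2 : ℝ) := by
    rw [← lintegral_const_mul _ (by fun_prop)]
    refine lintegral_mono fun ρ => ?_
    rw [← ENNReal.mul_rpow_of_nonneg _ _ (by norm_num)]
    refine ENNReal.rpow_le_rpow ?_ (by norm_num)
    by_cases hρ : ρ ∈ J
    · rw [hw, enorm_mul, mul_comm]
      refine mul_le_mul' ?_ le_rfl
      rw [← ofReal_norm, Complex.norm_real]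
      exact ENNReal.ofReal_le_ofReal (hB ρ hρ)
    · simp [hwJ ρ hρ]
  have heq : ∀ t : ℝ, ∫ ρ, m ρ * (Complex.exp (((t * (2 * Real.pi * ρ) : ℝ) : ℂ) * Complex.I) *
      (c ρ : ℂ)) = ∫ ρ, w ρ * Complex.exp (((t * (2 * Real.pi * ρ) : ℝ) : ℂ) * Complex.I) := by
    intro t
    refine integral_congr_ae (.of_forall fun ρ => ?_)
    simp only [hw]
    ring
  simp_rw [heq]
  constructor
  · intro t
    refine (enorm_integral_mul_le h.measJ hwm hwJ fun ρ => ?_).trans ?_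
    · rw [← ofReal_norm, Complex.norm_exp_ofReal_mul_I, ENNReal.ofReal_one]
    · have h3 := ENNReal.rpow_le_rpow hw2 (show (0 : ℝ) ≤ 1 / 2 by norm_num)
      rw [ENNReal.mul_rpow_of_nonneg _ _ (by norm_num), ← ENNReal.rpow_mul] at h3
      have h4 := ENNReal.rpow_le_rpow h.vol (show (0 : ℝ) ≤ 1 / 2 by norm_num)
      rw [show (2 : ℝ) * (1 / 2) = 1 by norm_num, ENNReal.rpow_one] at h3
      refine (mul_le_mul' h4 h3).trans (le_of_eq ?_)
      ring
  · rw [lintegral_fourier_profile hwm hwJ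
      ((h.vol.trans h.le_one).trans_lt ENNReal.one_lt_top).ne]
    · exact hw2
    · exact (hw2.trans_lt (ENNReal.mul_lt_top (by simp) h.sq.lt_top)).ne

/-- A majorant, constant on each unit shell `k ≤ r ≤ k + 1`, of the wave profile, with the bounds
in time that follow from Cauchy-Schwarz and Plancherel. -/
theorem exists_shell_majorant (n : ℕ) : ∃ D : ℝ≥0∞, D ≠ ∞ ∧
    ∀ (m : ℝ → ℂ) (J : Set ℝ) (δ : ℝ≥0∞), IsProfile m J δ → ∃ S : ℕ → ℝ → ℝ≥0∞,
      (∀ k, Measurable (S k)) ∧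
      (∀ t r, 0 ≤ r → ‖waveU n m t r‖ₑ ≤ S ⌊r⌋₊ t) ∧
      (∀ k t, S k t ≤ D * ENNReal.ofReal ((1 + k) ^ (-(n : ℝ) / 2)) * δ ^ (1 / 2 : ℝ) *
        (∫⁻ ρ, ‖m ρ‖ₑ ^ (2 : ℝ)) ^ (1 / 2 : ℝ)) ∧
      ∀ k, ∫⁻ t, S k t ^ (2 : ℝ) ≤ (D * ENNReal.ofReal ((1 + k) ^ (-(n : ℝ) / 2))) ^ (2 : ℝ) *
        ∫⁻ ρ, ‖m ρ‖ₑ ^ (2 : ℝ) := by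
  obtain ⟨C, hC, hK⟩ := exists_sphK_decay n
  set C₁ : ℝ := 2 * (C * 2 ^ ((n : ℝ) / 2)) with hC₁
  have hC₁0 : 0 < C₁ := by positivity
  refine ⟨ENNReal.ofReal (2 * C₁), ENNReal.ofReal_ne_top, fun m J δ h => ?_⟩
  set b : ℕ → ℝ := fun k => (1 + k) ^ (-(n : ℝ) / 2) with hb
  have hb0 : ∀ k, 0 < b k := fun k => by positivity
  set M := ∫⁻ ρ, ‖m ρ‖ₑ ^ (2 : ℝ)
  have hker : ∀ (k : ℕ) (s : ℝ), s ∈ Set.Icc (k : ℝ) (k + 1) → ∀ ρ ∈ J,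
      |sphK n (ρ * (2 * Real.pi * s))| ≤ C₁ * b k ∧
      |ρ * (2 * Real.pi) * sphK' n (ρ * (2 * Real.pi * s))| ≤ C₁ * b k := by
    intro k s hs ρ hρ
    obtain ⟨h1, h2⟩ := h.freq ρ hρ
    have hk0 : (0 : ℝ) ≤ k := k.cast_nonneg
    have hs0 : 0 ≤ s := hk0.trans hs.1
    have hx : ρ * (2 * Real.pi * s) = ρ * (2 * Real.pi) * s := by ring
    have hx0 : 0 ≤ ρ * (2 * Real.pi * s) := by rw [hx]; exact mul_nonneg (by linarith) hs0
    obtain ⟨h3, h4⟩ := hK _ hx0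
    -- `2πρ ≥ 1/2` gives `1 + 2πρs ≥ (1 + k) / 2`
    have h5 : (1 + ρ * (2 * Real.pi * s)) ^ (-(n : ℝ) / 2) ≤ 2 ^ ((n : ℝ) / 2) * b k := by
      have h6 : (1 + k : ℝ) / 2 ≤ 1 + ρ * (2 * Real.pi * s) := by
        rw [hx]; nlinarith [hs.1]
      have h7 : -(n : ℝ) / 2 ≤ 0 := by
        have : (0 : ℝ) ≤ n := n.cast_nonneg
        linarith
      refine (Real.rpow_le_rpow_of_nonpos (by positivity) h6 h7).trans (le_of_eq ?_)
      rw [Real.div_rpow (by positivity) (by norm_num), neg_div, Real.rpow_neg (by norm_num : (0:ℝ) ≤ 2),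
        div_inv_eq_mul, mul_comm, hb, neg_div]
    have h8 : C * (1 + ρ * (2 * Real.pi * s)) ^ (-(n : ℝ) / 2) ≤ C * 2 ^ ((n : ℝ) / 2) * b k := by
      exact (mul_le_mul_of_nonneg_left h5 hC.le).trans_eq (mul_assoc _ _ _).symm
    have h9 : 0 ≤ C * 2 ^ ((n : ℝ) / 2) * b k := by have := hb0 k; positivity
    refine ⟨by rw [hC₁]; linarith, ?_⟩
    rw [abs_mul, abs_of_nonneg (by linarith : 0 ≤ ρ * (2 * Real.pi)), hC₁,
      mul_assoc 2 (C * 2 ^ ((n : ℝ) / 2))]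
    exact mul_le_mul h2 (h4.trans h8) (abs_nonneg _) (by norm_num)
  have hk := continuous_sphK n
  have hk' := continuous_sphK' n
  have hU := fun (k : ℕ) (s : ℝ) (hs : s ∈ Set.Icc (k : ℝ) (k + 1)) =>
    h.wave_bounds (c := fun ρ => sphK n (ρ * (2 * Real.pi * s))) (by fun_prop)
      (fun ρ hρ => (hker k s hs ρ hρ).1)
  have hV := fun (k : ℕ) (s : ℝ) (hs : s ∈ Set.Icc (k : ℝ) (k + 1)) =>
    h.wave_bounds (c := fun ρ => ρ * (2 * Real.pi) * sphK' n (ρ * (2 * Real.pi * s)))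
      (by fun_prop) (fun ρ hρ => (hker k s hs ρ hρ).2)
  have hUc := h.continuous_waveU (n := n)
  have hVc := h.continuous_waveV (n := n)
  have hjoint : Measurable fun z : ℝ × ℝ => ‖waveU n m z.1 z.2‖ₑ + ‖waveV n m z.1 z.2‖ₑ :=
    hUc.measurable.enorm.add hVc.measurable.enorm
  have hDsplit : ∀ k, ENNReal.ofReal (2 * C₁) * ENNReal.ofReal (b k) =
      2 * ENNReal.ofReal (C₁ * b k) := by
    intro k
    rw [← ENNReal.ofReal_mul (by positivity), mul_assoc, ENNReal.ofReal_mul (by norm_num)]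
    simp
  refine ⟨fun k t => ∫⁻ s in Set.Icc (k : ℝ) (k + 1), (‖waveU n m t s‖ₑ + ‖waveV n m t s‖ₑ),
    fun k => ?_, fun t r hr => ?_, fun k t => ?_, fun k => ?_⟩
  · exact hjoint.lintegral_prod_right'
  · exact enorm_le_lintegral_add_deriv (h.hasDerivAt_waveU t)
      (hVc.comp (by fun_prop : Continuous fun s : ℝ => (t, s)))
      ⟨Nat.floor_le hr, (Nat.lt_floor_add_one r).le⟩
  · calc ∫⁻ s in Set.Icc (k : ℝ) (k + 1), (‖waveU n m t s‖ₑ + ‖waveV n m t s‖ₑ)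
        ≤ ∫⁻ s in Set.Icc (k : ℝ) (k + 1), (ENNReal.ofReal (2 * C₁) * ENNReal.ofReal (b k) *
          δ ^ (1 / 2 : ℝ) * M ^ (1 / 2 : ℝ)) := by
          refine setLIntegral_mono measurable_const fun s hs => ?_
          refine (add_le_add ((hU k s hs).1 t) ((hV k s hs).1 t)).trans (le_of_eq ?_)
          rw [hDsplit]
          ring
      _ = _ := by simp [hb]
  · calc ∫⁻ t, (∫⁻ s in Set.Icc (k : ℝ) (k + 1), (‖waveU n m t s‖ₑ + ‖waveV n m t s‖ₑ)) ^ (2 : ℝ)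
        ≤ ∫⁻ t, ∫⁻ s in Set.Icc (k : ℝ) (k + 1),
            (‖waveU n m t s‖ₑ + ‖waveV n m t s‖ₑ) ^ (2 : ℝ) := by
          refine lintegral_mono fun t => ?_
          refine (lintegral_rpow_two_le (hjoint.comp measurable_prodMk_left).aemeasurable).trans
            (le_of_eq ?_)
          simp
      _ = ∫⁻ s in Set.Icc (k : ℝ) (k + 1), ∫⁻ t,
            (‖waveU n m t s‖ₑ + ‖waveV n m t s‖ₑ) ^ (2 : ℝ) :=
          lintegral_lintegral_swap (hjoint.pow_const _).aemeasurable
      _ ≤ ∫⁻ s in Set.Icc (k : ℝ) (k + 1),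
            (2 * ENNReal.ofReal (C₁ * b k)) ^ (2 : ℝ) * M := by
          refine setLIntegral_mono measurable_const fun s hs => ?_
          have hmu : Measurable fun t => ‖waveU n m t s‖ₑ :=
            (hUc.measurable.comp measurable_prodMk_right).enorm
          have hmv : Measurable fun t => ‖waveV n m t s‖ₑ :=
            (hVc.measurable.comp measurable_prodMk_right).enorm
          calc ∫⁻ t, (‖waveU n m t s‖ₑ + ‖waveV n m t s‖ₑ) ^ (2 : ℝ)
              ≤ ∫⁻ t, 2 * (‖waveU n m t s‖ₑ ^ (2 : ℝ) + ‖waveV n m t s‖ₑ ^ (2 : ℝ)) := by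
                refine lintegral_mono fun t => ?_
                have := ENNReal.rpow_add_le_mul_rpow_add_rpow ‖waveU n m t s‖ₑ ‖waveV n m t s‖ₑ
                  (p := 2) (by norm_num)
                norm_num at this ⊢
                exact this
            _ = 2 * ((∫⁻ t, ‖waveU n m t s‖ₑ ^ (2 : ℝ)) + ∫⁻ t, ‖waveV n m t s‖ₑ ^ (2 : ℝ)) := by
                rw [lintegral_const_mul _ (by fun_prop), lintegral_add_left (by fun_prop)]
            _ ≤ 2 * (ENNReal.ofReal (C₁ * b k) ^ (2 : ℝ) * M +
                  ENNReal.ofReal (C₁ * b k) ^ (2 : ℝ) * M) := by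
                gcongr
                · exact (hU k s hs).2
                · exact (hV k s hs).2
            _ = _ := by
                rw [ENNReal.mul_rpow_of_nonneg _ _ (by norm_num)]
                norm_num
                ring
      _ = _ := by rw [hDsplit]; simp

end Profile

/-! ### Sums over unit shells -/

theorem rpow_tsum_le_tsum_rpow (a : ℕ → ℝ≥0∞) {θ : ℝ} (h0 : 0 < θ) (h1 : θ ≤ 1) :
    (∑' k, a k) ^ θ ≤ ∑' k, a k ^ θ := by
  have hfin : ∀ s : Finset ℕ, (∑ k ∈ s, a k) ^ θ ≤ ∑ k ∈ s, a k ^ θ := by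
    intro s
    induction s using Finset.cons_induction with
    | empty => simp [h0]
    | cons i s hi ih =>
      rw [Finset.sum_cons, Finset.sum_cons]
      exact (ENNReal.rpow_add_le_add_rpow _ _ h0.le h1).trans (add_le_add le_rfl ih)
  refine le_of_tendsto' ((ENNReal.summable (f := a)).hasSum.ennrpow_const θ) fun s => ?_
  exact (hfin s).trans (ENNReal.sum_le_tsum s)

theorem tsum_ofReal_rpow_ne_top {s : ℝ} (hs : s < -1) :
    ∑' k : ℕ, ENNReal.ofReal ((1 + k : ℝ) ^ s) ≠ ∞ := by
  have h : Summable fun k : ℕ => ((k : ℝ)) ^ s := Real.summable_nat_rpow.2 hs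
  have h1 := (summable_nat_add_iff 1).2 h
  refine Summable.tsum_ofReal_ne_top ?_
  refine h1.congr fun k => ?_
  push_cast
  rw [add_comm]

theorem measurableSet_shell (n k : ℕ) :
    MeasurableSet {x : EuclideanSpace ℝ (Fin (n + 1)) | ⌊‖x‖⌋₊ = k} :=
  (Nat.measurable_floor.comp measurable_norm) (measurableSet_singleton k)

theorem setLIntegral_shell (n k : ℕ) (β : ℝ) :
    ∫⁻ x in {x : EuclideanSpace ℝ (Fin (n + 1)) | ⌊‖x‖⌋₊ = k}, ENNReal.ofReal (‖x‖ ^ β) ≤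
      surf n Set.univ * ∫⁻ r in Set.Ioi (0 : ℝ) ∩ Set.Ico (k : ℝ) (k + 1),
        ENNReal.ofReal (r ^ ((n : ℝ) + β)) := by
  have hms : MeasurableSet {r : ℝ | ⌊r⌋₊ = k} := Nat.measurable_floor (measurableSet_singleton k)
  rw [← lintegral_indicator (measurableSet_shell n k)]
  have h1 := lintegral_radial (n := n)
    ({r : ℝ | ⌊r⌋₊ = k}.indicator fun r => ENNReal.ofReal (r ^ β))
    (Measurable.indicator (by fun_prop) hms)
  refine le_trans (le_of_eq ?_) (h1.le.trans (mul_le_mul' le_rfl ?_))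
  · rfl
  · rw [← lintegral_indicator measurableSet_Ioi,
      ← lintegral_indicator (measurableSet_Ioi.inter measurableSet_Ico)]
    refine lintegral_mono fun r => ?_
    by_cases hr : r ∈ Set.Ioi (0 : ℝ)
    · have hr0 : (0 : ℝ) < r := hr
      rw [Set.indicator_of_mem hr]
      by_cases hk : ⌊r⌋₊ = k
      · have hk' := (Nat.floor_eq_iff hr0.le).1 hk
        rw [Set.indicator_of_mem (show r ∈ {r : ℝ | ⌊r⌋₊ = k} from hk),
          Set.indicator_of_mem (show r ∈ Set.Ioi (0 : ℝ) ∩ Set.Ico (k : ℝ) (k + 1) from ⟨hr, hk'⟩),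
          ← ENNReal.ofReal_mul (by positivity), Real.rpow_add hr0, Real.rpow_natCast]
      · rw [Set.indicator_of_notMem (show r ∉ {r : ℝ | ⌊r⌋₊ = k} from hk), mul_zero]
        exact zero_le
    · rw [Set.indicator_of_notMem hr]
      exact zero_le

theorem rpow_le_of_mem_shell {k : ℕ} (hk : 1 ≤ k) {r : ℝ} (hr : r ∈ Set.Ico (k : ℝ) (k + 1))
    (s : ℝ) : r ^ s ≤ 2 ^ |s| * (1 + k : ℝ) ^ s := by
  have hk1 : (1 : ℝ) ≤ k := by exact_mod_cast hk
  have hr0 : 0 < r := by linarith [hr.1]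
  rcases le_total 0 s with hs | hs
  · have h1 : r ^ s ≤ (1 + k : ℝ) ^ s := Real.rpow_le_rpow hr0.le (by linarith [hr.2]) hs
    have h2 : (1 : ℝ) ≤ 2 ^ |s| := Real.one_le_rpow (by norm_num) (abs_nonneg s)
    exact h1.trans (le_mul_of_one_le_left (by positivity) h2)
  · rw [abs_of_nonpos hs, Real.rpow_neg (by norm_num), ← Real.inv_rpow (by norm_num),
      ← Real.mul_rpow (by norm_num) (by positivity)]
    exact Real.rpow_le_rpow_of_nonpos (by positivity) (by linarith [hr.1]) hs

/-- The mass of a power weight on the outer unit shells. -/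
theorem exists_setLIntegral_shell_le (n : ℕ) (β : ℝ) : ∃ W : ℝ≥0∞, W ≠ ∞ ∧ ∀ k : ℕ, 1 ≤ k →
    ∫⁻ x in {x : EuclideanSpace ℝ (Fin (n + 1)) | ⌊‖x‖⌋₊ = k}, ENNReal.ofReal (‖x‖ ^ β) ≤
      W * ENNReal.ofReal ((1 + k : ℝ) ^ (β + n)) := by
  refine ⟨surf n Set.univ * ENNReal.ofReal (2 ^ |(n : ℝ) + β|),
    ENNReal.mul_ne_top (measure_ne_top _ _) ENNReal.ofReal_ne_top, fun k hk => ?_⟩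
  refine (setLIntegral_shell n k β).trans ?_
  rw [mul_assoc]
  refine mul_le_mul' le_rfl ?_
  calc ∫⁻ r in Set.Ioi (0 : ℝ) ∩ Set.Ico (k : ℝ) (k + 1), ENNReal.ofReal (r ^ ((n : ℝ) + β))
      ≤ ∫⁻ r in Set.Ico (k : ℝ) (k + 1), ENNReal.ofReal (r ^ ((n : ℝ) + β)) :=
        lintegral_mono_set Set.inter_subset_right
    _ ≤ ∫⁻ r in Set.Ico (k : ℝ) (k + 1),
          ENNReal.ofReal (2 ^ |(n : ℝ) + β| * (1 + k : ℝ) ^ ((n : ℝ) + β)) :=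
        setLIntegral_mono measurable_const fun r hr =>
          ENNReal.ofReal_le_ofReal (rpow_le_of_mem_shell hk hr _)
    _ = _ := by
        rw [setLIntegral_const, Real.volume_Ico, ENNReal.ofReal_mul (by positivity), add_comm β]
        simp

/-- A power weight is integrable on the unit ball above the critical exponent. -/
theorem setLIntegral_shell_zero_ne_top (n : ℕ) {β : ℝ} (hβ : -((n : ℝ) + 1) < β) :
    ∫⁻ x in {x : EuclideanSpace ℝ (Fin (n + 1)) | ⌊‖x‖⌋₊ = 0}, ENNReal.ofReal (‖x‖ ^ β) ≠ ∞ := by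
  refine ((setLIntegral_shell n 0 β).trans_lt (ENNReal.mul_lt_top (measure_lt_top _ _) ?_)).ne
  have h : IntegrableOn (fun r : ℝ => r ^ ((n : ℝ) + β)) (Set.Ioo 0 1) :=
    (intervalIntegral.integrableOn_Ioo_rpow_iff one_pos).2 (by linarith)
  refine (lintegral_mono_set (t := Set.Ico (0 : ℝ) 1) ?_).trans_lt ?_
  · intro r hr; simpa using hr.2
  · rw [Measure.restrict_congr_set Ioo_ae_eq_Ico.symm]
    exact h.lintegral_lt_top

/-! ### Weighted mixed norms of functions with a shell majorant -/

section ShellBound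

/-- The bounds on a family `u t` of functions on `ℝⁿ⁺¹` from which the weighted mixed norm estimates
follow: `u t` has size at most `M` in `L²`, and on the shell `k ≤ |x| < k + 1` it is bounded by
`S k t`, which is controlled in `L^∞` and in `L²` in time. -/
structure ShellBound (n : ℕ) (D δ M : ℝ≥0∞) (u : ℝ → EuclideanSpace ℝ (Fin (n + 1)) → ℂ)
    (S : ℕ → ℝ → ℝ≥0∞) : Prop where
  meas : ∀ t, AEStronglyMeasurable (u t) volume
  measS : ∀ k, Measurable (S k)
  bound : ∀ t, ∀ᵐ x, ‖u t x‖ₑ ≤ S ⌊‖x‖⌋₊ t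
  sup : ∀ k t, S k t ≤ D * ENNReal.ofReal ((1 + k) ^ (-(n : ℝ) / 2)) * δ ^ (1 / 2 : ℝ) * M
  sq : ∀ k, ∫⁻ t, S k t ^ (2 : ℝ) ≤ (D * ENNReal.ofReal ((1 + k) ^ (-(n : ℝ) / 2)) * M) ^ (2 : ℝ)
  l2 : ∀ t, ∫⁻ x, ‖u t x‖ₑ ^ (2 : ℝ) ≤ M ^ (2 : ℝ)
  le_one : δ ≤ 1

variable {n : ℕ} {D δ M : ℝ≥0∞} {u : ℝ → EuclideanSpace ℝ (Fin (n + 1)) → ℂ}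
  {S : ℕ → ℝ → ℝ≥0∞}

/-- Interpolation between the `L^∞` and `L²` bounds in time. -/
theorem ShellBound.lintegral_rpow (h : ShellBound n D δ M u S) {Q : ℝ} (hQ : 2 ≤ Q) (k : ℕ) :
    ∫⁻ t, S k t ^ Q ≤
      (D * ENNReal.ofReal ((1 + k) ^ (-(n : ℝ) / 2)) * (δ ^ (1 / 2 - 1 / Q) * M)) ^ Q := by
  set b := D * ENNReal.ofReal ((1 + k) ^ (-(n : ℝ) / 2))
  have hQ0 : 0 < Q := by linarith
  have hQ2 : 0 ≤ Q - 2 := by linarith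
  have hsplit : ∀ y : ℝ≥0∞, y ^ Q = y ^ (Q - 2) * y ^ (2 : ℝ) := fun y => by
    rw [← ENNReal.rpow_add_of_nonneg _ _ hQ2 (by norm_num)]; congr 1; ring
  calc ∫⁻ t, S k t ^ Q ≤ ∫⁻ t, (b * δ ^ (1 / 2 : ℝ) * M) ^ (Q - 2) * S k t ^ (2 : ℝ) := by
        refine lintegral_mono fun t => ?_
        simp only [hsplit (S k t)]
        exact mul_le_mul' (ENNReal.rpow_le_rpow (h.sup k t) hQ2) le_rfl
    _ = (b * δ ^ (1 / 2 : ℝ) * M) ^ (Q - 2) * ∫⁻ t, S k t ^ (2 : ℝ) :=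
        lintegral_const_mul _ ((h.measS k).pow_const _)
    _ ≤ (b * δ ^ (1 / 2 : ℝ) * M) ^ (Q - 2) * (b * M) ^ (2 : ℝ) := mul_le_mul' le_rfl (h.sq k)
    _ = (b * (δ ^ (1 / 2 - 1 / Q) * M)) ^ Q := by
        rw [show b * δ ^ (1 / 2 : ℝ) * M = (b * M) * δ ^ (1 / 2 : ℝ) by ring,
          show b * (δ ^ (1 / 2 - 1 / Q) * M) = (b * M) * δ ^ (1 / 2 - 1 / Q) by ring,
          ENNReal.mul_rpow_of_nonneg _ _ hQ2, ENNReal.mul_rpow_of_nonneg _ _ hQ0.le,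
          ← ENNReal.rpow_mul, ← ENNReal.rpow_mul, hsplit (b * M)]
        rw [show (1 / 2 - 1 / Q) * Q = 1 / 2 * (Q - 2) by field_simp]
        ring

theorem ofReal_rpow_shell (k : ℕ) (s t : ℝ) : ENNReal.ofReal ((1 + k : ℝ) ^ s) ^ t =
    ENNReal.ofReal ((1 + k : ℝ) ^ (s * t)) := by
  rw [ENNReal.ofReal_rpow_of_pos (by positivity), ← Real.rpow_mul (by positivity)]

/-- Summing over shells in `ℓ^q` and integrating in time. -/
theorem ShellBound.lintegral_tsum_shell (h : ShellBound n D δ M u S) {Q : ℝ} (hQ : 2 ≤ Q)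
    {V : ℝ≥0∞} {γ : ℝ} (v : ℕ → ℝ≥0∞)
    (hv : ∀ k, v k ≤ V * ENNReal.ofReal ((1 + k : ℝ) ^ (Q * γ))) :
    ∫⁻ t, ∑' k, v k * S k t ^ Q ≤
      V * (∑' k : ℕ, ENNReal.ofReal ((1 + k : ℝ) ^ (Q * (γ - n / 2)))) * D ^ Q *
        (δ ^ (1 / 2 - 1 / Q) * M) ^ Q := by
  have hQ0 : 0 ≤ Q := by linarith
  have hS := h.measS
  rw [MeasureTheory.lintegral_tsum fun k => (((hS k).pow_const Q).const_mul (v k)).aemeasurable]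
  rw [← ENNReal.tsum_mul_left, ← ENNReal.tsum_mul_right, ← ENNReal.tsum_mul_right]
  refine ENNReal.tsum_le_tsum fun k => ?_
  rw [lintegral_const_mul _ ((hS k).pow_const Q)]
  refine (mul_le_mul' (hv k) (h.lintegral_rpow hQ k)).trans (le_of_eq ?_)
  rw [ENNReal.mul_rpow_of_nonneg _ _ hQ0, ENNReal.mul_rpow_of_nonneg _ _ hQ0, ofReal_rpow_shell]
  have : ENNReal.ofReal ((1 + k : ℝ) ^ (Q * (γ - n / 2))) =
      ENNReal.ofReal ((1 + k : ℝ) ^ (Q * γ)) * ENNReal.ofReal ((1 + k : ℝ) ^ (-(n : ℝ) / 2 * Q)) := by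
    rw [← ENNReal.ofReal_mul (by positivity), ← Real.rpow_add (by positivity)]
    ring_nf
  rw [this]
  ring

theorem enorm_weight_mul (x : EuclideanSpace ℝ (Fin (n + 1))) (α : ℝ) (z : ℂ) :
    ‖((‖x‖ ^ α : ℝ) : ℂ) * z‖ₑ = ENNReal.ofReal (‖x‖ ^ α) * ‖z‖ₑ := by
  rw [enorm_mul, ← ofReal_norm ((‖x‖ ^ α : ℝ) : ℂ), Complex.norm_real,
    Real.norm_of_nonneg (by positivity)]

theorem eLpNorm_weight_rpow (α : ℝ) {P : ℝ} (hP : 0 < P)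
    (w : EuclideanSpace ℝ (Fin (n + 1)) → ℂ) :
    eLpNorm (fun x => ((‖x‖ ^ α : ℝ) : ℂ) * w x) (ENNReal.ofReal P) volume ^ P =
      ∫⁻ x, ENNReal.ofReal (‖x‖ ^ (α * P)) * ‖w x‖ₑ ^ P := by
  rw [eLpNorm_eq_lintegral_rpow_enorm_toReal (by simpa using hP) ENNReal.ofReal_ne_top,
    ENNReal.toReal_ofReal hP.le, ← ENNReal.rpow_mul, one_div, inv_mul_cancel₀ hP.ne',
    ENNReal.rpow_one]
  refine lintegral_congr fun x => ?_
  rw [enorm_weight_mul, ENNReal.mul_rpow_of_nonneg _ _ hP.le,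
    ENNReal.ofReal_rpow_of_nonneg (by positivity) hP.le, ← Real.rpow_mul (norm_nonneg x)]

theorem eLpNorm_ofReal_enn {Q : ℝ} (hQ : 0 < Q) (N : ℝ → ℝ≥0∞) :
    eLpNorm N (ENNReal.ofReal Q) volume = (∫⁻ t, N t ^ Q) ^ (1 / Q) := by
  rw [eLpNorm_eq_lintegral_rpow_enorm_toReal (by simpa using hQ) ENNReal.ofReal_ne_top,
    ENNReal.toReal_ofReal hQ.le]
  simp

/-- Weighted integrals over a union of shells are bounded by sums over the shells. -/
theorem ShellBound.setLIntegral_le (h : ShellBound n D δ M u S) (t β : ℝ) {P : ℝ} (hP : 0 < P)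
    {A : Set ℕ} :
    ∫⁻ x in {x | ⌊‖x‖⌋₊ ∈ A}, ENNReal.ofReal (‖x‖ ^ β) * ‖u t x‖ₑ ^ P ≤
      ∑' k, A.indicator (fun k => ∫⁻ x in {x : EuclideanSpace ℝ (Fin (n + 1)) | ⌊‖x‖⌋₊ = k},
        ENNReal.ofReal (‖x‖ ^ β)) k * S k t ^ P := by
  have hA : MeasurableSet {x : EuclideanSpace ℝ (Fin (n + 1)) | ⌊‖x‖⌋₊ ∈ A} :=
    (Nat.measurable_floor.comp measurable_norm) (MeasurableSet.of_discrete (s := A))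
  rw [← lintegral_indicator hA]
  calc _ ≤ ∫⁻ x : EuclideanSpace ℝ (Fin (n + 1)), ∑' k, A.indicator (fun k =>
            {x : EuclideanSpace ℝ (Fin (n + 1)) | ⌊‖x‖⌋₊ = k}.indicator
              (fun x => ENNReal.ofReal (‖x‖ ^ β)) x) k * S k t ^ P := by
        refine lintegral_mono_ae ?_
        filter_upwards [h.bound t] with x hx
        by_cases hxA : ⌊‖x‖⌋₊ ∈ A
        · rw [Set.indicator_of_mem (show x ∈ {x | ⌊‖x‖⌋₊ ∈ A} from hxA)]
          refine le_trans ?_ (ENNReal.le_tsum ⌊‖x‖⌋₊)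
          rw [Set.indicator_of_mem hxA, Set.indicator_of_mem (by simp)]
          gcongr
        · rw [Set.indicator_of_notMem (show x ∉ {x | ⌊‖x‖⌋₊ ∈ A} from hxA)]
          exact zero_le
    _ = _ := by
        rw [lintegral_tsum]
        · refine tsum_congr fun k => ?_
          by_cases hk : k ∈ A
          · simp only [Set.indicator_of_mem hk]
            rw [lintegral_mul_const _ (Measurable.indicator (by fun_prop) (measurableSet_shell n k)),
              lintegral_indicator (measurableSet_shell n k)]
          · simp [hk]
        · intro k
          by_cases hk : k ∈ A
          · simp only [Set.indicator_of_mem hk]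
            exact ((Measurable.indicator (by fun_prop) (measurableSet_shell n k)).mul_const
              _).aemeasurable
          · simp [hk]

theorem ShellBound.lintegral_le (h : ShellBound n D δ M u S) (t β : ℝ) {P : ℝ} (hP : 0 < P) :
    ∫⁻ x, ENNReal.ofReal (‖x‖ ^ β) * ‖u t x‖ₑ ^ P ≤
      ∑' k, (∫⁻ x in {x : EuclideanSpace ℝ (Fin (n + 1)) | ⌊‖x‖⌋₊ = k},
        ENNReal.ofReal (‖x‖ ^ β)) * S k t ^ P := by
  simpa using h.setLIntegral_le t β hP (A := Set.univ)

/-- The case `q ≤ p < ∞`: since `q / p ≤ 1`, the `q`-th power of the `L^p` norm is at most the sum of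
the `q`-th powers of the norms over the shells. -/
theorem exists_mixed_le_of_le (n : ℕ) (D : ℝ≥0∞) (hD : D ≠ ∞) {α P Q : ℝ} (hQ : 2 ≤ Q)
    (hQP : Q ≤ P) (h1 : -((n : ℝ) + 1) / P < α) (h2 : α < n * (1 / 2 - 1 / P) - 1 / Q) :
    ∃ C : ℝ≥0∞, C ≠ ∞ ∧ ∀ δ M u S, ShellBound n D δ M u S →
      eLpNorm (fun t => eLpNorm (fun x => ((‖x‖ ^ α : ℝ) : ℂ) * u t x) (ENNReal.ofReal P) volume)
        (ENNReal.ofReal Q) volume ≤ C * (δ ^ (1 / 2 - 1 / Q) * M) := by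
  have hQ0 : 0 < Q := by linarith
  have hP0 : 0 < P := by linarith
  have h1' : -((n : ℝ) + 1) < α * P := by rwa [div_lt_iff₀ hP0] at h1
  obtain ⟨W₁, hW₁, hW⟩ := exists_setLIntegral_shell_le n (α * P)
  have hw0 := setLIntegral_shell_zero_ne_top n h1'
  set w : ℕ → ℝ≥0∞ := fun k => ∫⁻ x in {x : EuclideanSpace ℝ (Fin (n + 1)) | ⌊‖x‖⌋₊ = k},
        ENNReal.ofReal (‖x‖ ^ (α * P)) with hw
  have hWw : ∀ k : ℕ, w k ≤ (W₁ + w 0) * ENNReal.ofReal ((1 + k : ℝ) ^ (α * P + n)) := by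
    intro k
    rcases Nat.eq_zero_or_pos k with rfl | hk
    · simp
    · exact (hW k hk).trans (mul_le_mul' le_self_add le_rfl)
  have hsum := tsum_ofReal_rpow_ne_top (s := Q * (α + n / P - n / 2)) (by
    have : Q * (α + n / P - n / 2) < Q * (-(1 / Q)) := by
      apply mul_lt_mul_of_pos_left _ hQ0
      have : (n : ℝ) * (1 / 2 - 1 / P) = n / 2 - n / P := by ring
      linarith
    rwa [mul_neg, mul_one_div_cancel hQ0.ne'] at this)
  refine ⟨((W₁ + w 0) ^ (Q / P) *
      (∑' k : ℕ, ENNReal.ofReal ((1 + k : ℝ) ^ (Q * (α + n / P - n / 2)))) * D ^ Q) ^ (1 / Q),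
    ENNReal.rpow_ne_top_of_nonneg (by positivity) (ENNReal.mul_ne_top (ENNReal.mul_ne_top
      (ENNReal.rpow_ne_top_of_nonneg (by positivity) (ENNReal.add_ne_top.2 ⟨hW₁, hw0⟩)) hsum)
      (ENNReal.rpow_ne_top_of_nonneg hQ0.le hD)), fun δ M u S h => ?_⟩
  rw [eLpNorm_ofReal_enn hQ0]
  have hpt : ∀ t, eLpNorm (fun x => ((‖x‖ ^ α : ℝ) : ℂ) * u t x) (ENNReal.ofReal P) volume ^ Q ≤
      ∑' k, w k ^ (Q / P) * S k t ^ Q := by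
    intro t
    rw [show Q = P * (Q / P) by field_simp, ENNReal.rpow_mul, eLpNorm_weight_rpow α hP0]
    refine (ENNReal.rpow_le_rpow (h.lintegral_le t (α * P) hP0) (by positivity)).trans ?_
    refine (rpow_tsum_le_tsum_rpow _ (by positivity) ((div_le_one hP0).2 hQP)).trans (le_of_eq ?_)
    refine tsum_congr fun k => ?_
    rw [ENNReal.mul_rpow_of_nonneg _ _ (by positivity), ← ENNReal.rpow_mul]
    congr 2
    field_simp
  have hv : ∀ k : ℕ, w k ^ (Q / P) ≤
      (W₁ + w 0) ^ (Q / P) * ENNReal.ofReal ((1 + k : ℝ) ^ (Q * (α + n / P))) := by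
    intro k
    refine (ENNReal.rpow_le_rpow (hWw k) (by positivity)).trans (le_of_eq ?_)
    rw [ENNReal.mul_rpow_of_nonneg _ _ (by positivity), ofReal_rpow_shell]
    congr 3
    field_simp
  have := (lintegral_mono hpt).trans (h.lintegral_tsum_shell hQ _ hv)
  refine (ENNReal.rpow_le_rpow this (by positivity)).trans (le_of_eq ?_)
  rw [ENNReal.mul_rpow_of_nonneg _ _ (by positivity), ← ENNReal.rpow_mul _ Q,
    mul_one_div_cancel hQ0.ne', ENNReal.rpow_one]

theorem weight_le_shell (x : EuclideanSpace ℝ (Fin (n + 1))) {α : ℝ} (hα : 0 ≤ α) :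
    ‖x‖ ^ α ≤ (1 + ⌊‖x‖⌋₊ : ℝ) ^ α :=
  Real.rpow_le_rpow (norm_nonneg x) (by have := Nat.lt_floor_add_one ‖x‖; linarith) hα

/-- The case `q < p = ∞`: the supremum over the shells is bounded by their `ℓ^q` sum. -/
theorem exists_mixed_le_top (n : ℕ) (D : ℝ≥0∞) (hD : D ≠ ∞) {α Q : ℝ} (hQ : 2 ≤ Q)
    (h1 : 0 ≤ α) (h2 : α < n / 2 - 1 / Q) :
    ∃ C : ℝ≥0∞, C ≠ ∞ ∧ ∀ δ M u S, ShellBound n D δ M u S →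
      eLpNorm (fun t => eLpNorm (fun x => ((‖x‖ ^ α : ℝ) : ℂ) * u t x) ∞ volume)
        (ENNReal.ofReal Q) volume ≤ C * (δ ^ (1 / 2 - 1 / Q) * M) := by
  have hQ0 : 0 < Q := by linarith
  have hsum := tsum_ofReal_rpow_ne_top (s := Q * (α - n / 2)) (by
    have : Q * (α - n / 2) < Q * (-(1 / Q)) :=
      mul_lt_mul_of_pos_left (by linarith) hQ0
    rwa [mul_neg, mul_one_div_cancel hQ0.ne'] at this)
  refine ⟨(1 * (∑' k : ℕ, ENNReal.ofReal ((1 + k : ℝ) ^ (Q * (α - n / 2)))) * D ^ Q) ^ (1 / Q),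
    ENNReal.rpow_ne_top_of_nonneg (by positivity) (ENNReal.mul_ne_top (ENNReal.mul_ne_top
      ENNReal.one_ne_top hsum)
      (ENNReal.rpow_ne_top_of_nonneg hQ0.le hD)), fun δ M u S h => ?_⟩
  rw [eLpNorm_ofReal_enn hQ0]
  have hpt : ∀ t, eLpNorm (fun x => ((‖x‖ ^ α : ℝ) : ℂ) * u t x) ∞ volume ^ Q ≤
      ∑' k : ℕ, ENNReal.ofReal ((1 + k : ℝ) ^ (Q * α)) * S k t ^ Q := by
    intro t
    set T := ∑' k : ℕ, ENNReal.ofReal ((1 + k : ℝ) ^ (Q * α)) * S k t ^ Q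
    have : eLpNorm (fun x => ((‖x‖ ^ α : ℝ) : ℂ) * u t x) ∞ volume ≤ T ^ (1 / Q) := by
      rw [eLpNorm_exponent_top]
      refine eLpNormEssSup_le_of_ae_enorm_bound ?_
      filter_upwards [h.bound t] with x hx
      rw [enorm_weight_mul, one_div, ENNReal.le_rpow_inv_iff hQ0, ENNReal.mul_rpow_of_nonneg _ _ hQ0.le]
      refine le_trans ?_ (ENNReal.le_tsum ⌊‖x‖⌋₊)
      refine mul_le_mul' ?_ (ENNReal.rpow_le_rpow hx hQ0.le)
      rw [mul_comm Q, ← ofReal_rpow_shell]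
      exact ENNReal.rpow_le_rpow (ENNReal.ofReal_le_ofReal (weight_le_shell x h1)) hQ0.le
    rwa [one_div, ENNReal.le_rpow_inv_iff hQ0] at this
  have := (lintegral_mono hpt).trans (h.lintegral_tsum_shell (V := 1) (γ := α) hQ _ fun k => by simp)
  refine (ENNReal.rpow_le_rpow this (by positivity)).trans (le_of_eq ?_)
  rw [ENNReal.mul_rpow_of_nonneg _ _ (by positivity), ← ENNReal.rpow_mul _ Q,
    mul_one_div_cancel hQ0.ne', ENNReal.rpow_one]

/-- The radial decay estimate, uniformly in time. -/
theorem ShellBound.weighted_sup (h : ShellBound n D δ M u S) {α : ℝ} (h1 : 0 ≤ α)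
    (h2 : α ≤ n / 2) (t : ℝ) :
    ∀ᵐ x, ENNReal.ofReal (‖x‖ ^ α) * ‖u t x‖ₑ ≤ D * (δ ^ (1 / 2 : ℝ) * M) := by
  filter_upwards [h.bound t] with x hx
  refine (mul_le_mul' le_rfl (hx.trans (h.sup _ t))).trans ?_
  have h3 : ENNReal.ofReal (‖x‖ ^ α) * ENNReal.ofReal ((1 + ⌊‖x‖⌋₊ : ℝ) ^ (-(n : ℝ) / 2)) ≤ 1 := by
    rw [← ENNReal.ofReal_mul (by positivity), ENNReal.ofReal_le_one]
    calc ‖x‖ ^ α * (1 + ⌊‖x‖⌋₊ : ℝ) ^ (-(n : ℝ) / 2)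
        ≤ (1 + ⌊‖x‖⌋₊ : ℝ) ^ α * (1 + ⌊‖x‖⌋₊ : ℝ) ^ (-(n : ℝ) / 2) := by
          exact mul_le_mul_of_nonneg_right (weight_le_shell x h1) (by positivity)
      _ = (1 + ⌊‖x‖⌋₊ : ℝ) ^ (α - n / 2) := by
          rw [← Real.rpow_add (by positivity)]; ring_nf
      _ ≤ 1 := Real.rpow_le_one_of_one_le_of_nonpos (by simp) (by linarith)
  calc _ = ENNReal.ofReal (‖x‖ ^ α) * ENNReal.ofReal ((1 + ⌊‖x‖⌋₊ : ℝ) ^ (-(n : ℝ) / 2)) *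
        (D * (δ ^ (1 / 2 : ℝ) * M)) := by ring
    _ ≤ 1 * (D * (δ ^ (1 / 2 : ℝ) * M)) := mul_le_mul' h3 le_rfl
    _ = _ := one_mul _

/-- The case `q = p = ∞`. -/
theorem ShellBound.mixed_top_top (h : ShellBound n D δ M u S) {α : ℝ} (h1 : 0 ≤ α)
    (h2 : α ≤ n / 2) :
    eLpNorm (fun t => eLpNorm (fun x => ((‖x‖ ^ α : ℝ) : ℂ) * u t x) ∞ volume) ∞ volume ≤
      D * (δ ^ (1 / 2 : ℝ) * M) := by
  rw [eLpNorm_exponent_top]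
  refine eLpNormEssSup_le_of_ae_enorm_bound (.of_forall fun t => ?_)
  rw [enorm_eq_self, eLpNorm_exponent_top]
  refine eLpNormEssSup_le_of_ae_enorm_bound ?_
  filter_upwards [h.weighted_sup h1 h2 t] with x hx
  rwa [enorm_weight_mul]

theorem measurableSet_outer (n : ℕ) :
    MeasurableSet {x : EuclideanSpace ℝ (Fin (n + 1)) | ⌊‖x‖⌋₊ ∈ ({0}ᶜ : Set ℕ)} :=
  (Nat.measurable_floor.comp measurable_norm) (MeasurableSet.of_discrete (s := {0}ᶜ))

theorem one_le_norm_of_outer {x : EuclideanSpace ℝ (Fin (n + 1))}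
    (hx : ⌊‖x‖⌋₊ ∈ ({0}ᶜ : Set ℕ)) : 1 ≤ ‖x‖ := by
  by_contra hc
  exact hx (Nat.floor_eq_zero.2 (not_le.1 hc))

/-- Outside the unit ball, at the endpoint weight, the `L^p` norm at fixed time interpolates between
the radial decay estimate and conservation of the `L²` norm. -/
theorem ShellBound.setLIntegral_outer_le (h : ShellBound n D δ M u S) {P β : ℝ} (hP : 2 ≤ P)
    (hβ : β ≤ n * (P - 2) / 2) (t : ℝ) :
    ∫⁻ x in {x | ⌊‖x‖⌋₊ ∈ ({0}ᶜ : Set ℕ)}, ENNReal.ofReal (‖x‖ ^ β) * ‖u t x‖ₑ ^ P ≤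
      D ^ (P - 2) * (δ ^ (1 / 2 - 1 / P) * M) ^ P := by
  have hP2 : 0 ≤ P - 2 := by linarith
  have hP0 : 0 < P := by linarith
  have hsplit : ∀ y : ℝ≥0∞, y ^ P = y ^ (P - 2) * y ^ (2 : ℝ) := fun y => by
    rw [← ENNReal.rpow_add_of_nonneg _ _ hP2 (by norm_num)]; congr 1; ring
  have hm := (h.meas t).enorm
  calc ∫⁻ x in {x | ⌊‖x‖⌋₊ ∈ ({0}ᶜ : Set ℕ)}, ENNReal.ofReal (‖x‖ ^ β) * ‖u t x‖ₑ ^ P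
      ≤ ∫⁻ x in {x | ⌊‖x‖⌋₊ ∈ ({0}ᶜ : Set ℕ)},
          (D * (δ ^ (1 / 2 : ℝ) * M)) ^ (P - 2) * ‖u t x‖ₑ ^ (2 : ℝ) := by
        refine lintegral_mono_ae ?_
        filter_upwards [ae_restrict_of_ae (h.weighted_sup (α := n / 2) (by positivity) le_rfl t),
          ae_restrict_mem (measurableSet_outer n)] with x hx hxo
        have hx1 := one_le_norm_of_outer hxo
        have h3 : ENNReal.ofReal (‖x‖ ^ β) ≤ ENNReal.ofReal (‖x‖ ^ ((n : ℝ) / 2)) ^ (P - 2) := by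
          rw [ENNReal.ofReal_rpow_of_nonneg (by positivity) hP2, ← Real.rpow_mul (norm_nonneg x)]
          exact ENNReal.ofReal_le_ofReal
            (Real.rpow_le_rpow_of_exponent_le hx1 (hβ.trans (le_of_eq (by ring))))
        rw [hsplit, ← mul_assoc]
        refine mul_le_mul' ((mul_le_mul' h3 le_rfl).trans ?_) le_rfl
        rw [← ENNReal.mul_rpow_of_nonneg _ _ hP2]
        exact ENNReal.rpow_le_rpow hx hP2
    _ = (D * (δ ^ (1 / 2 : ℝ) * M)) ^ (P - 2) *
          ∫⁻ x in {x | ⌊‖x‖⌋₊ ∈ ({0}ᶜ : Set ℕ)}, ‖u t x‖ₑ ^ (2 : ℝ) :=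
        lintegral_const_mul'' _ (hm.pow_const _).restrict
    _ ≤ (D * (δ ^ (1 / 2 : ℝ) * M)) ^ (P - 2) * M ^ (2 : ℝ) :=
        mul_le_mul' le_rfl ((setLIntegral_le_lintegral _ _).trans (h.l2 t))
    _ = D ^ (P - 2) * (δ ^ (1 / 2 - 1 / P) * M) ^ P := by
        rw [ENNReal.mul_rpow_of_nonneg _ _ hP2, ENNReal.mul_rpow_of_nonneg _ _ hP2,
          ENNReal.mul_rpow_of_nonneg _ _ hP0.le, hsplit M, ← ENNReal.rpow_mul, ← ENNReal.rpow_mul,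
          show (1 / 2 - 1 / P) * P = 1 / 2 * (P - 2) by field_simp]
        ring

/-- Split of the weighted `L^p` norm at the unit ball. -/
theorem ShellBound.eLpNorm_rpow_le (h : ShellBound n D δ M u S) (α t : ℝ) {P : ℝ} (hP : 0 < P) :
    eLpNorm (fun x => ((‖x‖ ^ α : ℝ) : ℂ) * u t x) (ENNReal.ofReal P) volume ^ P ≤
      (∫⁻ x in {x : EuclideanSpace ℝ (Fin (n + 1)) | ⌊‖x‖⌋₊ = 0},
        ENNReal.ofReal (‖x‖ ^ (α * P))) * S 0 t ^ P +
      ∫⁻ x in {x | ⌊‖x‖⌋₊ ∈ ({0}ᶜ : Set ℕ)},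
        ENNReal.ofReal (‖x‖ ^ (α * P)) * ‖u t x‖ₑ ^ P := by
  rw [eLpNorm_weight_rpow α hP,
    ← lintegral_add_compl _ (measurableSet_shell n 0)]
  refine add_le_add ?_ le_rfl
  have h1 := h.setLIntegral_le t (α * P) hP (A := {0})
  rw [tsum_eq_single 0 (fun k hk => by simp [hk])] at h1
  simpa using h1

/-- The case `q = ∞`, `p < ∞`: at each time, the unit ball is controlled by the uniform bound and the
outer region by `ShellBound.setLIntegral_outer_le`. -/
theorem exists_mixed_top_le (n : ℕ) (D : ℝ≥0∞) (hD : D ≠ ∞) {α P : ℝ} (hP : 2 ≤ P)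
    (h1 : -((n : ℝ) + 1) / P < α) (h2 : α ≤ n * (1 / 2 - 1 / P)) :
    ∃ C : ℝ≥0∞, C ≠ ∞ ∧ ∀ δ M u S, ShellBound n D δ M u S →
      eLpNorm (fun t => eLpNorm (fun x => ((‖x‖ ^ α : ℝ) : ℂ) * u t x) (ENNReal.ofReal P) volume)
        ∞ volume ≤ C * (δ ^ (1 / 2 - 1 / P) * M) := by
  have hP0 : 0 < P := by linarith
  have h1' : -((n : ℝ) + 1) < α * P := by rwa [div_lt_iff₀ hP0] at h1
  have h2' : α * P ≤ n * (P - 2) / 2 := by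
    have := mul_le_mul_of_nonneg_right h2 hP0.le
    refine this.trans (le_of_eq ?_)
    field_simp
  have hw0 := setLIntegral_shell_zero_ne_top n h1'
  set w := ∫⁻ x in {x : EuclideanSpace ℝ (Fin (n + 1)) | ⌊‖x‖⌋₊ = 0},
        ENNReal.ofReal (‖x‖ ^ (α * P))
  refine ⟨(w * D ^ P + D ^ (P - 2)) ^ (1 / P), ENNReal.rpow_ne_top_of_nonneg (by positivity)
    (ENNReal.add_ne_top.2 ⟨ENNReal.mul_ne_top hw0 (ENNReal.rpow_ne_top_of_nonneg hP0.le hD),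
      ENNReal.rpow_ne_top_of_nonneg (by linarith) hD⟩), fun δ M u S h => ?_⟩
  rw [eLpNorm_exponent_top]
  refine eLpNormEssSup_le_of_ae_enorm_bound (.of_forall fun t => ?_)
  have hS0 : S 0 t ≤ D * (δ ^ (1 / 2 - 1 / P) * M) := by
    refine (h.sup 0 t).trans ?_
    have : δ ^ (1 / 2 : ℝ) ≤ δ ^ (1 / 2 - 1 / P) :=
      ENNReal.rpow_le_rpow_of_exponent_ge h.le_one (by have : 0 < 1 / P := by positivity
                                                       linarith)
    simp only [Nat.cast_zero, add_zero, Real.one_rpow, ENNReal.ofReal_one, mul_one, mul_assoc]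
    gcongr
  rw [enorm_eq_self, ← ENNReal.rpow_le_rpow_iff hP0]
  refine (h.eLpNorm_rpow_le α t hP0).trans ?_
  refine (add_le_add (mul_le_mul' le_rfl (ENNReal.rpow_le_rpow hS0 hP0.le))
    (h.setLIntegral_outer_le hP h2' t)).trans (le_of_eq ?_)
  rw [ENNReal.mul_rpow_of_nonneg _ _ hP0.le, ENNReal.mul_rpow_of_nonneg _ (δ ^ _ * M) hP0.le,
    ← ENNReal.rpow_mul, one_div_mul_cancel hP0.ne', ENNReal.rpow_one]
  ring

/-- The case `p < q < ∞`. Outside the unit ball the weight `α` is a convex combination of the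
endpoint weight for `q = ∞` and of an admissible weight for `q = p`. -/
theorem exists_mixed_le_of_lt (n : ℕ) (D : ℝ≥0∞) (hD : D ≠ ∞) {α P Q : ℝ} (hP : 2 ≤ P)
    (hPQ : P < Q) (h1 : -((n : ℝ) + 1) / P < α) (h2 : α < n * (1 / 2 - 1 / P) - 1 / Q) :
    ∃ C : ℝ≥0∞, C ≠ ∞ ∧ ∀ δ M u S, ShellBound n D δ M u S →
      eLpNorm (fun t => eLpNorm (fun x => ((‖x‖ ^ α : ℝ) : ℂ) * u t x) (ENNReal.ofReal P) volume)
        (ENNReal.ofReal Q) volume ≤ C * (δ ^ (1 / 2 - 1 / P) * M) := by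
  have hP0 : 0 < P := by linarith
  have hQ0 : 0 < Q := by linarith
  have hQP : 0 ≤ Q / P - 1 := by rw [sub_nonneg, one_le_div hP0]; exact hPQ.le
  have h1' : -((n : ℝ) + 1) < α * P := by rwa [div_lt_iff₀ hP0] at h1
  have hw0 := setLIntegral_shell_zero_ne_top n h1'
  set w := ∫⁻ x in {x : EuclideanSpace ℝ (Fin (n + 1)) | ⌊‖x‖⌋₊ = 0},
        ENNReal.ofReal (‖x‖ ^ (α * P))
  set α₁ : ℝ := n * (1 / 2 - 1 / P) with hα₁
  -- the weight `α₀` with `α = (P / Q) α₀ + (1 - P / Q) α₁`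
  set α₀ : ℝ := α₁ + (α - α₁) * (Q / P) with hα₀
  have hα₀' : α₀ + n / P - n / 2 < -(1 / P) := by
    have h3 : (α - α₁) * (Q / P) < (-(1 / Q)) * (Q / P) :=
      mul_lt_mul_of_pos_right (by linarith) (by positivity)
    have h4 : (-(1 / Q)) * (Q / P) = -(1 / P) := by field_simp
    have h5 : α₁ = n / 2 - n / P := by rw [hα₁]; ring
    rw [hα₀]
    linarith
  obtain ⟨W, hWt, hW⟩ := exists_setLIntegral_shell_le n (α₀ * P)
  have hsum := tsum_ofReal_rpow_ne_top (s := P * (α₀ + n / P - n / 2)) (by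
    have := mul_lt_mul_of_pos_left hα₀' hP0
    rwa [mul_neg, mul_one_div_cancel hP0.ne'] at this)
  set Z := ∑' k : ℕ, ENNReal.ofReal ((1 + k : ℝ) ^ (P * (α₀ + n / P - n / 2)))
  set K := (2 : ℝ≥0∞) ^ (Q / P - 1) * (w ^ (Q / P) * D ^ Q +
    (W * Z * D ^ P) * (D ^ (P - 2)) ^ (Q / P - 1)) with hK
  refine ⟨K ^ (1 / Q), ?_, fun δ M u S h => ?_⟩
  · refine ENNReal.rpow_ne_top_of_nonneg (by positivity) (ENNReal.mul_ne_top
      (ENNReal.rpow_ne_top_of_nonneg hQP (by norm_num)) (ENNReal.add_ne_top.2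
      ⟨ENNReal.mul_ne_top (ENNReal.rpow_ne_top_of_nonneg (by positivity) hw0)
        (ENNReal.rpow_ne_top_of_nonneg hQ0.le hD),
      ENNReal.mul_ne_top (ENNReal.mul_ne_top (ENNReal.mul_ne_top hWt hsum)
        (ENNReal.rpow_ne_top_of_nonneg hP0.le hD)) (ENNReal.rpow_ne_top_of_nonneg hQP
        (ENNReal.rpow_ne_top_of_nonneg (by linarith) hD))⟩))
  set X := δ ^ (1 / 2 - 1 / P) * M with hX
  set v : ℕ → ℝ≥0∞ := ({0}ᶜ : Set ℕ).indicator fun k =>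
    ∫⁻ x in {x : EuclideanSpace ℝ (Fin (n + 1)) | ⌊‖x‖⌋₊ = k}, ENNReal.ofReal (‖x‖ ^ (α₀ * P))
    with hv
  have hvW : ∀ k, v k ≤ W * ENNReal.ofReal ((1 + k : ℝ) ^ (P * (α₀ + n / P))) := by
    intro k
    by_cases hk : k = 0
    · simp [hv, hk]
    · rw [hv, Set.indicator_of_mem (by simpa using hk)]
      refine (hW k (Nat.one_le_iff_ne_zero.2 hk)).trans (le_of_eq ?_)
      congr 3
      field_simp
  -- the time dependence of the norm need not be measurable, so it is bounded by a measurable function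
  have hpt : ∀ t, eLpNorm (fun x => ((‖x‖ ^ α : ℝ) : ℂ) * u t x) (ENNReal.ofReal P) volume ^ Q ≤
      2 ^ (Q / P - 1) * (w ^ (Q / P) * S 0 t ^ Q +
        (D ^ (P - 2) * X ^ P) ^ (Q / P - 1) * ∑' k, v k * S k t ^ P) := by
    intro t
    have hm := (h.meas t).enorm
    set o := {x : EuclideanSpace ℝ (Fin (n + 1)) | ⌊‖x‖⌋₊ ∈ ({0}ᶜ : Set ℕ)}
    have hB : (∫⁻ x in o, ENNReal.ofReal (‖x‖ ^ (α * P)) * ‖u t x‖ₑ ^ P) ^ (Q / P) ≤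
        (D ^ (P - 2) * X ^ P) ^ (Q / P - 1) * ∑' k, v k * S k t ^ P := by
      have hθ : P / Q + (1 - P / Q) = 1 := by ring
      have hθ1 : 0 ≤ 1 - P / Q := by rw [sub_nonneg, div_le_one hQ0]; exact hPQ.le
      have hmw : ∀ β : ℝ, AEMeasurable (fun x : EuclideanSpace ℝ (Fin (n + 1)) =>
          ENNReal.ofReal (‖x‖ ^ β) * ‖u t x‖ₑ ^ P) (volume.restrict o) := fun β =>
        ((by fun_prop : Measurable fun x : EuclideanSpace ℝ (Fin (n + 1)) =>
          ENNReal.ofReal (‖x‖ ^ β)).aemeasurable.mul (hm.pow_const P)).restrict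
      have hH := ENNReal.lintegral_mul_norm_pow_le (hmw (α₀ * P)) (hmw (α₁ * P))
        (p := P / Q) (q := 1 - P / Q) (by positivity) hθ1 hθ
      have hle : ∫⁻ x in o, ENNReal.ofReal (‖x‖ ^ (α * P)) * ‖u t x‖ₑ ^ P ≤
          ∫⁻ x in o, (ENNReal.ofReal (‖x‖ ^ (α₀ * P)) * ‖u t x‖ₑ ^ P) ^ (P / Q) *
            (ENNReal.ofReal (‖x‖ ^ (α₁ * P)) * ‖u t x‖ₑ ^ P) ^ (1 - P / Q) := by
        refine lintegral_mono_ae ?_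
        filter_upwards [ae_restrict_mem (measurableSet_outer n)] with x hx
        have hx0 : 0 < ‖x‖ := by linarith [one_le_norm_of_outer hx]
        rw [ENNReal.mul_rpow_of_nonneg _ _ (by positivity), ENNReal.mul_rpow_of_nonneg _ _ hθ1,
          mul_mul_mul_comm, ← ENNReal.rpow_add_of_nonneg _ _ (by positivity) hθ1, hθ,
          ENNReal.rpow_one, ENNReal.ofReal_rpow_of_pos (by positivity),
          ENNReal.ofReal_rpow_of_pos (by positivity), ← ENNReal.ofReal_mul (by positivity),
          ← Real.rpow_mul hx0.le, ← Real.rpow_mul hx0.le, ← Real.rpow_add hx0]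
        refine mul_le_mul' (ENNReal.ofReal_le_ofReal (le_of_eq ?_)) le_rfl
        congr 1
        rw [hα₀]
        field_simp
        ring
      have hB0 := h.setLIntegral_le t (α₀ * P) hP0 (A := {0}ᶜ)
      have hB1 := h.setLIntegral_outer_le hP (β := α₁ * P)
        (le_of_eq (by rw [hα₁]; field_simp)) t
      have h3 := hle.trans (hH.trans (mul_le_mul' (ENNReal.rpow_le_rpow hB0 (by positivity))
        (ENNReal.rpow_le_rpow hB1 hθ1)))
      refine (ENNReal.rpow_le_rpow h3 (show 0 ≤ Q / P by positivity)).trans (le_of_eq ?_)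
      rw [ENNReal.mul_rpow_of_nonneg _ _ (by positivity), ← ENNReal.rpow_mul, ← ENNReal.rpow_mul,
        show P / Q * (Q / P) = 1 by field_simp, ENNReal.rpow_one,
        show (1 - P / Q) * (Q / P) = Q / P - 1 by field_simp, mul_comm]
    have hQe : Q = P * (Q / P) := by field_simp
    calc eLpNorm (fun x => ((‖x‖ ^ α : ℝ) : ℂ) * u t x) (ENNReal.ofReal P) volume ^ Q
        = (eLpNorm (fun x => ((‖x‖ ^ α : ℝ) : ℂ) * u t x) (ENNReal.ofReal P) volume ^ P) ^
            (Q / P) := by rw [← ENNReal.rpow_mul, ← hQe]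
      _ ≤ (w * S 0 t ^ P + ∫⁻ x in o, ENNReal.ofReal (‖x‖ ^ (α * P)) * ‖u t x‖ₑ ^ P) ^
            (Q / P) := ENNReal.rpow_le_rpow (h.eLpNorm_rpow_le α t hP0) (by positivity)
      _ ≤ 2 ^ (Q / P - 1) * ((w * S 0 t ^ P) ^ (Q / P) +
            (∫⁻ x in o, ENNReal.ofReal (‖x‖ ^ (α * P)) * ‖u t x‖ₑ ^ P) ^ (Q / P)) :=
          ENNReal.rpow_add_le_mul_rpow_add_rpow _ _ (by linarith)
      _ ≤ _ := by
          rw [ENNReal.mul_rpow_of_nonneg _ _ (by positivity), ← ENNReal.rpow_mul, ← hQe]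
          gcongr
  have hS0 : ∫⁻ t, S 0 t ^ Q ≤ (D * X) ^ Q := by
    refine (h.lintegral_rpow (by linarith) 0).trans (ENNReal.rpow_le_rpow ?_ hQ0.le)
    have : δ ^ (1 / 2 - 1 / Q) ≤ δ ^ (1 / 2 - 1 / P) := by
      refine ENNReal.rpow_le_rpow_of_exponent_ge h.le_one ?_
      have := one_div_le_one_div_of_le hP0 hPQ.le
      linarith
    simp only [Nat.cast_zero, add_zero, Real.one_rpow, ENNReal.ofReal_one, mul_one, hX]
    gcongr
  have hint : ∫⁻ t, eLpNorm (fun x => ((‖x‖ ^ α : ℝ) : ℂ) * u t x) (ENNReal.ofReal P) volume ^ Q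
      ≤ K * X ^ Q := by
    have hS := h.measS
    have hmt : Measurable fun t => ∑' k, v k * S k t ^ P :=
      Measurable.tsum fun k => ((hS k).pow_const P).const_mul (v k)
    refine (lintegral_mono hpt).trans ?_
    have hm0 : Measurable (S 0) := hS 0
    rw [lintegral_const_mul _ (by fun_prop),
      lintegral_add_left (((hS 0).pow_const Q).const_mul _), lintegral_const_mul _ ((hS 0).pow_const Q),
      lintegral_const_mul _ hmt, hK, mul_assoc]
    refine mul_le_mul' le_rfl ?_
    rw [add_mul]
    refine add_le_add ?_ ?_
    · refine (mul_le_mul' le_rfl hS0).trans (le_of_eq ?_)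
      rw [ENNReal.mul_rpow_of_nonneg _ _ hQ0.le, mul_assoc]
    · refine (mul_le_mul' le_rfl (h.lintegral_tsum_shell hP v hvW)).trans (le_of_eq ?_)
      have hXQ : X ^ Q = (X ^ P) ^ (Q / P - 1) * X ^ P := by
        rw [← ENNReal.rpow_mul, ← ENNReal.rpow_add_of_nonneg _ _ (by positivity) hP0.le]
        congr 1
        field_simp
        ring
      rw [ENNReal.mul_rpow_of_nonneg _ _ hQP, hXQ]
      ring
  rw [eLpNorm_ofReal_enn hQ0]
  refine (ENNReal.rpow_le_rpow hint (by positivity)).trans (le_of_eq ?_)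
  rw [ENNReal.mul_rpow_of_nonneg _ _ (by positivity), ← ENNReal.rpow_mul X,
    mul_one_div_cancel hQ0.ne', ENNReal.rpow_one]

end ShellBound

/-! ### The admissible range of exponents -/

theorem recip_ofReal {P : ℝ} (hP : 0 < P) : recip (ENNReal.ofReal P) = 1 / P := by
  rw [recip, ENNReal.toReal_inv, ENNReal.toReal_ofReal hP.le, one_div]

theorem recip_top : recip ∞ = 0 := by simp [recip]

/-- The weighted mixed norm estimate for any family with a shell majorant, in the whole admissible
range. -/
theorem exists_mixed_of_admissible (n : ℕ) (D : ℝ≥0∞) (hD : D ≠ ∞) {α : ℝ} {q p : ℝ≥0∞}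
    (hadm : Admissible (n + 1) α q p) :
    ∃ C : ℝ≥0∞, C ≠ ∞ ∧ ∀ δ M u S, ShellBound n D δ M u S →
      eLpNorm (fun t => eLpNorm (fun x => ((‖x‖ ^ α : ℝ) : ℂ) * u t x) p volume) q volume ≤
        C * (δ ^ (1 / 2 - recip (min p q)) * M) := by
  have hreal : ∀ r : ℝ≥0∞, 2 ≤ r → r < ∞ → ∃ R : ℝ, 2 ≤ R ∧ r = ENNReal.ofReal R := by
    intro r h1 h2
    refine ⟨r.toReal, ?_, (ENNReal.ofReal_toReal h2.ne).symm⟩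
    rw [← ENNReal.ofReal_le_iff_le_toReal h2.ne]
    simpa using h1
  have hn : (((n + 1 : ℕ) : ℝ) - 1) = n := by push_cast; ring
  rw [Admissible, hn] at hadm
  rcases hadm with ⟨⟨hq2, hq⟩, ⟨hp2, hp⟩, h1, h2⟩ | ⟨rfl, ⟨hp2, hp⟩, h1, h2⟩ |
    ⟨⟨hq2, hq⟩, rfl, h1, h2⟩ | ⟨rfl, rfl, h1, h2⟩
  · obtain ⟨Q, hQ, rfl⟩ := hreal q hq2 hq
    obtain ⟨P, hP, rfl⟩ := hreal p hp2 hp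
    rw [recip_ofReal (by linarith)] at h1 h2
    rw [recip_ofReal (by linarith)] at h2
    have h1' : -((n : ℝ) + 1) / P < α := by
      refine lt_of_eq_of_lt ?_ h1
      push_cast
      ring
    rcases le_or_gt Q P with h | h
    · rw [min_eq_right (ENNReal.ofReal_le_ofReal h), recip_ofReal (by linarith)]
      exact exists_mixed_le_of_le n D hD hQ h h1' h2
    · rw [min_eq_left (ENNReal.ofReal_le_ofReal h.le), recip_ofReal (by linarith)]
      exact exists_mixed_le_of_lt n D hD hP h h1' h2
  · obtain ⟨P, hP, rfl⟩ := hreal p hp2 hp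
    rw [recip_ofReal (by linarith)] at h1 h2
    rw [min_eq_left le_top, recip_ofReal (by linarith)]
    refine exists_mixed_top_le n D hD hP (lt_of_eq_of_lt ?_ h1) h2
    push_cast
    ring
  · obtain ⟨Q, hQ, rfl⟩ := hreal q hq2 hq
    rw [recip_ofReal (by linarith)] at h2
    rw [min_eq_right le_top, recip_ofReal (by linarith)]
    exact exists_mixed_le_top n D hD hQ h1 h2
  · refine ⟨D, hD, fun δ M u S h => ?_⟩
    rw [min_self, recip_top, sub_zero]
    exact h.mixed_top_top h1 h2

theorem enorm_halfWave_le {d : ℕ} (t : ℝ) (f : L2 d) : ‖halfWave t f‖ₑ ≤ ‖f‖ₑ := by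
  have h1 : ‖halfWave t f‖ₑ = ‖((memLp_phase t (𝓕 f : L2 d)).toLp _ : L2 d)‖ₑ := by
    rw [halfWave, ← ofReal_norm, norm_fourierInv_L2, ofReal_norm]
  have h2 : ‖(𝓕 f : L2 d)‖ₑ = ‖f‖ₑ := by
    rw [← ofReal_norm, Lp.norm_fourier_eq, ofReal_norm]
  rw [h1, ← h2, Lp.enorm_def, Lp.enorm_def, eLpNorm_congr_ae (MemLp.coeFn_toLp _)]
  refine eLpNorm_mono fun x => ?_
  rw [norm_mul, Complex.norm_exp_ofReal_mul_I, one_mul]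

/-- A radial half-wave with frequencies in a set of measure at most `δ` has a shell majorant. -/
theorem exists_shellBound (n : ℕ) : ∃ D : ℝ≥0∞, D ≠ ∞ ∧
    ∀ (f : L2 (n + 1)) (δ : ℝ≥0∞) (I : Set ℝ), IsRadial f → δ ≤ 1 → I.OrdConnected →
      I ⊆ Set.Icc (1 / 2) 2 → volume I ≤ δ →
      (∀ᵐ ξ : EuclideanSpace ℝ (Fin (n + 1)), ‖ξ‖ ∉ I → hat f ξ = 0) →
      ∀ σ : ℝ, σ = 1 ∨ σ = -1 → ∃ u S, ShellBound n D δ ‖f‖ₑ u S ∧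
        ∀ t, halfWave (σ * t) f =ᵐ[volume] u t := by
  obtain ⟨D, hD, hmaj⟩ := exists_shell_majorant n
  have hs0 : surf n Set.univ ≠ 0 := by
    rw [Ne, Measure.measure_univ_eq_zero]
    exact Measure.toSphere_ne_zero _
  have hst : surf n Set.univ ≠ ∞ := measure_ne_top _ _
  set c := (surf n Set.univ)⁻¹ with hc
  have hct : c ≠ ∞ := ENNReal.inv_ne_top.2 hs0
  refine ⟨D * c ^ (1 / 2 : ℝ), ENNReal.mul_ne_top hD
    (ENNReal.rpow_ne_top_of_nonneg (by norm_num) hct), fun f δ I hf hδ hI hI2 hvol hsupp σ hσ => ?_⟩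
  obtain ⟨m, hm, hmI, hmf, hwave⟩ := exists_profile hf hI hI2 hsupp
  have hm2 : ∫⁻ ρ, ‖m ρ‖ₑ ^ (2 : ℝ) ≤ c * ‖f‖ₑ ^ (2 : ℝ) := by
    rw [hc, ← ENNReal.div_eq_inv_mul, ENNReal.le_div_iff_mul_le (.inl hs0) (.inl hst), mul_comm]
    exact hmf
  have hm2' : (∫⁻ ρ, ‖m ρ‖ₑ ^ (2 : ℝ)) ^ (1 / 2 : ℝ) ≤ c ^ (1 / 2 : ℝ) * ‖f‖ₑ := by
    refine (ENNReal.rpow_le_rpow hm2 (by norm_num)).trans (le_of_eq ?_)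
    rw [ENNReal.mul_rpow_of_nonneg _ _ (by norm_num), ← ENNReal.rpow_mul]
    norm_num
  have hπ : (1 : ℝ) ≤ 2 * Real.pi := by have := Real.pi_gt_three; linarith
  have hprof : IsProfile m {ρ | 2 * Real.pi * ρ ∈ I} δ :=
    { meas := hm
      measJ := hI.measurableSet.preimage (by fun_prop)
      zero := hmI
      freq := fun ρ hρ => by
        have := hI2 hρ
        rw [mul_comm]
        exact this
      vol := by
        have h1 : volume {ρ | 2 * Real.pi * ρ ∈ I} = _ :=
          Real.volume_preimage_mul_left (show 2 * Real.pi ≠ 0 by positivity) I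
        rw [h1]
        refine le_trans (mul_le_of_le_one_left' ?_) hvol
        rw [ENNReal.ofReal_le_one, abs_of_pos (by positivity)]
        exact inv_le_one_of_one_le₀ hπ
      le_one := hδ
      sq := (hm2.trans_lt (ENNReal.mul_lt_top hct.lt_top
        (ENNReal.rpow_lt_top_of_nonneg (by norm_num) enorm_ne_top))).ne }
  obtain ⟨S, hS, hU, hsup, hsq⟩ := hmaj m _ δ hprof
  have hae : ∀ t, halfWave (σ * t) f =ᵐ[volume] fun x => waveU n m (σ * t) ‖x‖ :=
    fun t => hwave (σ * t)
  have hcomp : ∀ k, ∫⁻ t, S k (σ * t) ^ (2 : ℝ) = ∫⁻ t, S k t ^ (2 : ℝ) := by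
    intro k
    rcases hσ with rfl | rfl
    · simp
    · have := (Measure.measurePreserving_neg (volume : Measure ℝ)).lintegral_comp
        ((hS k).pow_const (2 : ℝ))
      simpa using this
  have hUc := hprof.continuous_waveU (n := n)
  refine ⟨fun t x => waveU n m (σ * t) ‖x‖, fun k t => S k (σ * t),
    { meas := fun t => ?_
      measS := fun k => (hS k).comp (by fun_prop)
      bound := fun t => .of_forall fun x => hU _ _ (norm_nonneg x)
      sup := fun k t => ?_
      sq := fun k => ?_
      l2 := fun t => ?_
      le_one := hδ }, hae⟩
  · exact (hUc.comp (by fun_prop : Continuous fun x : EuclideanSpace ℝ (Fin (n + 1)) =>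
      (σ * t, ‖x‖))).aestronglyMeasurable
  · refine (hsup k (σ * t)).trans ((mul_le_mul' le_rfl hm2').trans (le_of_eq ?_))
    ring
  · rw [hcomp]
    refine (hsq k).trans ((mul_le_mul' le_rfl hm2).trans (le_of_eq ?_))
    rw [show D * c ^ (1 / 2 : ℝ) * ENNReal.ofReal ((1 + k) ^ (-(n : ℝ) / 2)) * ‖f‖ₑ =
        D * ENNReal.ofReal ((1 + k) ^ (-(n : ℝ) / 2)) * (c ^ (1 / 2 : ℝ) * ‖f‖ₑ) by ring,
      ENNReal.mul_rpow_of_nonneg _ (c ^ (1 / 2 : ℝ) * ‖f‖ₑ) (by norm_num),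
      ENNReal.mul_rpow_of_nonneg (c ^ (1 / 2 : ℝ)) _ (by norm_num), ← ENNReal.rpow_mul c]
    norm_num
  · rw [← eLpNorm_two_rpow, ← eLpNorm_congr_ae (hae t), ← Lp.enorm_def]
    exact ENNReal.rpow_le_rpow (enorm_halfWave_le _ f) (by norm_num)

end RadialStrichartz

theorem proposition3p1 (d : ℕ) (hd : 1 ≤ d) (α : ℝ) (q p : ℝ≥0∞)
    (hadm : RadialStrichartz.Admissible d α q p) :
    ∃ C : ℝ, 0 < C ∧
      ∀ (f : RadialStrichartz.L2 d) (δ : ℝ) (I : Set ℝ),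
        RadialStrichartz.IsRadial f →
        0 < δ → δ ≤ 1 →
        I.OrdConnected → I ⊆ Set.Icc (1 / 2) 2 → volume I ≤ ENNReal.ofReal δ →
        (∀ᵐ ξ : EuclideanSpace ℝ (Fin d), ‖ξ‖ ∉ I → RadialStrichartz.hat f ξ = 0) →
        ∀ σ : ℝ, σ = 1 ∨ σ = -1 →
          RadialStrichartz.weightedMixedNorm α q p
              (fun t : ℝ => RadialStrichartz.halfWave (σ * t) f) ≤
            ENNReal.ofReal
              (C * δ ^ (1 / 2 - RadialStrichartz.recip (min p q)) * ‖f‖) := by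
  obtain ⟨n, rfl⟩ : ∃ n, d = n + 1 := ⟨d - 1, by omega⟩
  obtain ⟨D, hD, hshell⟩ := RadialStrichartz.exists_shellBound n
  obtain ⟨C, hC, hmixed⟩ := RadialStrichartz.exists_mixed_of_admissible n D hD hadm
  refine ⟨C.toReal + 1, by positivity, fun f δ I hf hδ hδ1 hI hI2 hvol hsupp σ hσ => ?_⟩
  obtain ⟨u, S, hu, hae⟩ := hshell f (ENNReal.ofReal δ) I hf (ENNReal.ofReal_le_one.2 hδ1) hI hI2
    hvol hsupp σ hσ
  have hnorm : RadialStrichartz.weightedMixedNorm α q p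
      (fun t : ℝ => RadialStrichartz.halfWave (σ * t) f) =
      eLpNorm (fun t => eLpNorm (fun x => ((‖x‖ ^ α : ℝ) : ℂ) * u t x) p volume) q volume := by
    rw [RadialStrichartz.weightedMixedNorm]
    congr 1
    funext t
    refine eLpNorm_congr_ae ?_
    filter_upwards [hae t] with x hx
    rw [hx]
  rw [hnorm]
  refine (hmixed _ _ u S hu).trans ?_
  rw [mul_assoc, ENNReal.ofReal_mul (by positivity), ENNReal.ofReal_mul (by positivity),
    ENNReal.ofReal_rpow_of_pos hδ, ofReal_norm]
  refine mul_le_mul' ?_ le_rfl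
  rw [← ENNReal.ofReal_toReal hC]
  exact ENNReal.ofReal_le_ofReal (by simp)
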